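/- Let $s\in(-1,1)$, $s\neq 0$. Let $C_n^{(\alpha)}$ denote the Gegenbauer polynomials in standard normalisation ($C_0^{(\alpha)}=1$, $C_1^{(\alpha)}(x)=2\alpha x$, $(n+2)C_{n+2}^{(\alpha)}(x)=2(n+1+\alpha)xC_{n+1}^{(\alpha)}(x)-(n+2\alpha)C_n^{(\alpha)}(x)$), and set $$h_n=\frac{\pi\,2^{1-s}\,\Gamma(n+s)}{n!\,(n+s/2)\,\Gamma(s/2)^2},\qquad \lambda_n=\frac{\pi\,\Gamma(n+s)}{\Gamma(s)\,\Gamma(n+1)\cos(\pi s/2)} .$$ Let $u:[-1,1]\to\mathbb R$ be smooth ($C^\infty$ up to the endpoints). Consider the integral equation $$-\operatorname{sgn}(s)\int_{-1}^{1}\frac{1}{|x-x'|^{s}}\,\Delta n(x')\,dx'=u(x)+C,\qquad x\in(-1,1),\tag{1}$$ for an integrable function $\Delta n$ on $(-1,1)$, where the constant $C$ is to be such that $$\int_{-1}^{1}\Delta n(x')\,dx'=0.\tag{2}$$ The solution is $$\Delta n(x)=-\operatorname{sgn}(s)\,(1-x^2)^{(s-1)/2}\sum_{n=1}^{\infty}\frac{1}{h_n\lambda_n}\Big(\int_{-1}^{1}(1-y^2)^{(s-1)/2}C_n^{(s/2)}(y)\,u(y)\,dy\Big)C_n^{(s/2)}(x),\qquad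 x\in(-1,1).\tag{3}$$ That is: the integrals and the series in (3) converge absolutely for every $x\in(-1,1)$; the function (3) is integrable, satisfies (2) and, for a constant $C$, satisfies (1) at every $x\in(-1,1)$ with an absolutely convergent integral. Conversely, if an integrable function $f$ with $\int_{-1}^1 f=0$ satisfies (1) for almost every $x\in(-1,1)$ with some constant $C'$, then $C'=C$ and $f$ equals (3) almost everywhere on $(-1,1)$, and at every point of $(-1,1)$ at which $f$ is continuous. -/

import Mathlib

open Set MeasureTheory Polynomial
open scoped ContDiff Interval

noncomputable section

/-- The Gegenbauer (ultraspherical) polynomials `C_n^{(α)}` in the standard normalisation, through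
the three-term recurrence `C_0 = 1`, `C_1 = 2 α X`,
`(n+2) C_{n+2} = 2 (n+1+α) X C_{n+1} - (n + 2 α) C_n`. -/
def gegenbauer (α : ℝ) : ℕ → ℝ[X]
  | 0 => 1
  | 1 => C (2 * α) * X
  | n + 2 => C (1 / ((n : ℝ) + 2)) *
      (C (2 * ((n : ℝ) + 1 + α)) * X * gegenbauer α (n + 1)
        - C ((n : ℝ) + 2 * α) * gegenbauer α n)

/-- `h_n = π 2^{1-s} Γ(n+s) / (n! (n + s/2) Γ(s/2)²)`. -/
def gegenbauerNorm (s : ℝ) (n : ℕ) : ℝ :=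
  Real.pi * (2 : ℝ) ^ (1 - s) * Real.Gamma (n + s) /
    ((n.factorial : ℝ) * (n + s / 2) * Real.Gamma (s / 2) ^ 2)

/-- `λ_n = π Γ(n+s) / (Γ(s) Γ(n+1) cos(π s / 2))`. -/
def rieszEigenvalue (s : ℝ) (n : ℕ) : ℝ :=
  Real.pi * Real.Gamma (n + s) /
    (Real.Gamma s * Real.Gamma ((n : ℝ) + 1) * Real.cos (Real.pi * s / 2))

/-- The integrand `(1 - y²)^{(s-1)/2} C_n^{(s/2)}(y) u(y)`. -/
def gegenbauerIntegrand (s : ℝ) (u : ℝ → ℝ) (n : ℕ) (y : ℝ) : ℝ :=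
  (1 - y ^ 2) ^ ((s - 1) / 2) * (gegenbauer (s / 2) n).eval y * u y

/-- The `n`-th term
`(1 / (h_n λ_n)) (∫_{-1}^1 (1 - y²)^{(s-1)/2} C_n^{(s/2)}(y) u(y) dy) C_n^{(s/2)}(x)`. -/
def rieszSolutionTerm (s : ℝ) (u : ℝ → ℝ) (x : ℝ) (n : ℕ) : ℝ :=
  1 / (gegenbauerNorm s n * rieszEigenvalue s n) *
    (∫ y in (-1 : ℝ)..1, gegenbauerIntegrand s u n y) * (gegenbauer (s / 2) n).eval x

/-- The explicit solution: `-sgn(s) (1 - x²)^{(s-1)/2}` times the sum over `n ≥ 1` of the terms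
`rieszSolutionTerm s u x n`. -/
def rieszSolution (s : ℝ) (u : ℝ → ℝ) (x : ℝ) : ℝ :=
  -Real.sign s * (1 - x ^ 2) ^ ((s - 1) / 2) * ∑' n : ℕ, rieszSolutionTerm s u x (n + 1)

/-- The density `f` satisfies the integral equation
`-sgn(s) ∫_{-1}^1 |x - x'|^{-s} f(x') dx' = u(x) + c` at the point `x`, the integral being
absolutely convergent. -/
def RieszEquationAt (s : ℝ) (u : ℝ → ℝ) (c : ℝ) (f : ℝ → ℝ) (x : ℝ) : Prop :=
  IntervalIntegrable (fun x' => |x - x'| ^ (-s) * f x') volume (-1) 1 ∧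
    -Real.sign s * (∫ x' in (-1 : ℝ)..1, |x - x'| ^ (-s) * f x') = u x + c

end

namespace Riesz

/-! ### Algebra of the Gegenbauer polynomials -/

/-! Write `w = (1 - y²)^((s-1)/2)` and `T p (x) = ∫ |x - y|^(-s) w(y) p(y) dy`. The key fact is that
`T` is diagonal in the Gegenbauer polynomials, `T C_n = λ_n C_n` (`potential_gegenbauer`).

It has three ingredients. First, `T 1` is constant (`kernel_weight`): a Möbius substitution,
symmetrisation and one more substitution remove `x` from the integral, leaving a beta integral.
Secondly, `T` is triangular on polynomials (`exists_potential_eq`): since `(x - y)|x - y|^(-s)` is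
an antiderivative in `x` of `(1 - s)|x - y|^(-s)`, `T (X p)` equals `x T p - (1 - s) ∫₀ˣ T p` up to
a constant, so each step in degree multiplies the diagonal entry by `1 - (1 - s)/(n + 1)`, the ratio
`λ_{n+1}/λ_n`. Thirdly, `T` is symmetric for the weight (`potential_symm`). A triangular symmetric
operator is diagonal in the orthogonal basis.

For existence, expand `u` in the `C_n` and divide the coefficients by `λ_n`. Green's formula makes
the coefficients of a smooth `u` decay faster than any power (`exists_abs_gegenbauerCoeff_le`), `h_n
λ_n` decays at most polynomially (`exists_le_norm_mul_eigenvalue`), and the `C_n` are uniformly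
bounded on `[-1, 1]` by Sonin's argument (`exists_abs_gegenbauer_le`). So the series converge
absolutely and `T` acts termwise. Omitting `n = 0` makes the total integral vanish, and the missing
constant term of `u` is what `C` absorbs.

For uniqueness, if an integrable `f` of integral zero has constant potential `κ`, pairing with `w
C_n` gives `λ_n ∫ f C_n = κ ∫ w C_n`. The case `n = 0` gives `κ = 0`; then `f` is orthogonal to all
polynomials, hence zero almost everywhere. -/

theorem gegenbauer_rec (α : ℝ) (n : ℕ) :
    ((n : ℝ[X]) + 2) * gegenbauer α (n + 2) =
      2 * ((n : ℝ[X]) + 1 + C α) * X * gegenbauer α (n + 1)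
        - ((n : ℝ[X]) + 2 * C α) * gegenbauer α n := by
  have h : ((n : ℝ[X]) + 2) * C (1 / ((n : ℝ) + 2)) = 1 := by
    have h1 : ((n : ℝ[X]) + 2) = C ((n : ℝ) + 2) := by rw [map_add, map_natCast, map_ofNat C 2]
    have h2 : (n : ℝ) + 2 ≠ 0 := by positivity
    rw [h1, ← C_mul, mul_one_div_cancel h2, C_1]
  rw [gegenbauer, ← mul_assoc, h, one_mul]
  have h2 : (C 2 : ℝ[X]) = 2 := map_ofNat C 2
  simp only [map_add, map_mul, map_natCast, map_one, h2]

theorem natCast_add_two_ne_zero (n : ℕ) : ((n : ℝ[X]) + 2) ≠ 0 := by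
  have : ((n : ℝ[X]) + 2) = ((n + 2 : ℕ) : ℝ[X]) := by push_cast; ring
  rw [this]; exact_mod_cast (by omega : n + 2 ≠ 0)

/-- The two relations feed each other, so one induction carries both. -/
theorem gegenbauer_derivative_relations (α : ℝ) (n : ℕ) :
    ((n : ℝ[X]) + 1) * gegenbauer α (n + 1) =
        X * derivative (gegenbauer α (n + 1)) - derivative (gegenbauer α n) ∧
      ((n : ℝ[X]) + 2 * C α) * gegenbauer α n =
        derivative (gegenbauer α (n + 1)) - X * derivative (gegenbauer α n) := by
  induction n with
  | zero =>
    constructor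
    · simp [gegenbauer]
      ring
    · have : (2 : ℝ[X]) = C 2 := (map_ofNat C 2).symm
      simp [gegenbauer, this]
  | succ n ih =>
    obtain ⟨h1, h2⟩ := ih
    have hr := gegenbauer_rec α n
    have hd := congrArg derivative hr
    simp only [derivative_mul, derivative_add, derivative_sub, derivative_natCast,
      derivative_ofNat, derivative_one, derivative_C, derivative_X] at hd
    have h3 : (((n + 1 : ℕ) : ℝ[X]) + 2 * C α) * gegenbauer α (n + 1) =
        derivative (gegenbauer α (n + 2)) - X * derivative (gegenbauer α (n + 1)) := by
      -- In the differentiated recurrence, the derivative of `C_n` is eliminated with `h1`.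
      apply mul_left_cancel₀ (natCast_add_two_ne_zero n)
      push_cast
      linear_combination (n + 2 * C α) * h1 - hd
    refine ⟨?_, h3⟩
    push_cast at h3 ⊢
    linear_combination hr + X * h3 + X * h1 - h2

theorem gegenbauer_first_order (α : ℝ) (n : ℕ) :
    (1 - X ^ 2) * derivative (gegenbauer α (n + 1)) =
      ((n : ℝ[X]) + 2 * C α) * gegenbauer α n
        - ((n : ℝ[X]) + 1) * X * gegenbauer α (n + 1) := by
  obtain ⟨h1, h2⟩ := gegenbauer_derivative_relations α n
  linear_combination X * h1 - h2

/-- Differentiate the first-order relation and eliminate the derivative of the lower polynomial. -/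
theorem gegenbauer_ode (α : ℝ) (n : ℕ) :
    (1 - X ^ 2) * derivative (derivative (gegenbauer α n))
        - (2 * C α + 1) * X * derivative (gegenbauer α n)
        + (n : ℝ[X]) * ((n : ℝ[X]) + 2 * C α) * gegenbauer α n = 0 := by
  cases n with
  | zero => simp [gegenbauer]
  | succ n =>
    obtain ⟨h1, h2⟩ := gegenbauer_derivative_relations α n
    have hd := congrArg derivative (gegenbauer_first_order α n)
    simp only [derivative_mul, derivative_add, derivative_sub, derivative_natCast, derivative_pow,
      derivative_ofNat, derivative_one, derivative_C, derivative_X] at hd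
    push_cast at hd ⊢
    have h3 : (C 2 : ℝ[X]) = 2 := map_ofNat C 2
    rw [h3] at hd
    linear_combination hd + (n + 2 * C α) * h1

/-- The coefficient of `X ^ n` in the `n`-th Gegenbauer polynomial. -/
noncomputable def gegenbauerLead (α : ℝ) : ℕ → ℝ
  | 0 => 1
  | n + 1 => 2 * (n + α) / (n + 1) * gegenbauerLead α n

theorem gegenbauer_degree_aux (α : ℝ) (n : ℕ) :
    ((gegenbauer α n).natDegree ≤ n ∧ (gegenbauer α n).coeff n = gegenbauerLead α n) ∧
    ((gegenbauer α (n + 1)).natDegree ≤ n + 1 ∧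
      (gegenbauer α (n + 1)).coeff (n + 1) = gegenbauerLead α (n + 1)) := by
  induction n with
  | zero =>
    refine ⟨⟨by simp [gegenbauer], by simp [gegenbauer, gegenbauerLead]⟩, ?_, ?_⟩
    · simp only [gegenbauer]
      exact (natDegree_C_mul_le _ _).trans (by simp)
    · simp [gegenbauer, gegenbauerLead]
  | succ n ih =>
    obtain ⟨⟨a1, a2⟩, b1, b2⟩ := ih
    refine ⟨⟨b1, b2⟩, ?_, ?_⟩
    · rw [gegenbauer]
      refine (natDegree_C_mul_le _ _).trans ((natDegree_sub_le _ _).trans (max_le ?_ ?_))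
      · rw [mul_assoc]
        refine (natDegree_C_mul_le _ _).trans (natDegree_mul_le.trans ?_)
        rw [natDegree_X]; omega
      · exact (natDegree_C_mul_le _ _).trans (by omega)
    · have hz : (gegenbauer α n).coeff (n + 1 + 1) = 0 :=
        coeff_eq_zero_of_natDegree_lt (by omega)
      have h2 : (n : ℝ) + 2 ≠ 0 := by positivity
      rw [gegenbauer, coeff_C_mul, coeff_sub, mul_assoc, coeff_C_mul, coeff_X_mul, coeff_C_mul, hz,
        b2, show n + 2 = (n + 1) + 1 from rfl, gegenbauerLead.eq_2 α (n + 1)]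
      push_cast
      field_simp
      ring

theorem gegenbauer_natDegree_le (α : ℝ) (n : ℕ) : (gegenbauer α n).natDegree ≤ n :=
  (gegenbauer_degree_aux α n).1.1

theorem gegenbauer_coeff_self (α : ℝ) (n : ℕ) :
    (gegenbauer α n).coeff n = gegenbauerLead α n :=
  (gegenbauer_degree_aux α n).1.2

/-- This gives `C_n` exact degree `n`, so the `C_n` span all polynomials. -/
theorem gegenbauerLead_ne_zero {α : ℝ} (h0 : α ≠ 0) (h1 : -1 < α) (n : ℕ) :
    gegenbauerLead α n ≠ 0 := by
  induction n with
  | zero => simp [gegenbauerLead]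
  | succ n ih =>
    have h2 : (n : ℝ) + α ≠ 0 := by
      rcases Nat.eq_zero_or_pos n with rfl | hn
      · simpa using h0
      · have : (1 : ℝ) ≤ n := by exact_mod_cast hn
        linarith
    have : (n : ℝ) + 1 ≠ 0 := by positivity
    rw [gegenbauerLead]
    positivity

/-- A linear functional that vanishes on `C_0, …, C_{n-1}` vanishes on all polynomials of degree
less than `n`. -/
theorem linear_eq_zero_of_gegenbauer {α : ℝ} (h0 : α ≠ 0) (h1 : -1 < α) (l : ℝ[X] →ₗ[ℝ] ℝ) (n : ℕ)
    (hl : ∀ k < n, l (gegenbauer α k) = 0) (p : ℝ[X]) (hp : p.degree < n) : l p = 0 := by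
  induction n generalizing p with
  | zero =>
    have : p = 0 := by
      rw [← degree_eq_bot]; simpa using hp
    simp [this]
  | succ n ih =>
    set c := p.coeff n / gegenbauerLead α n
    have hne := gegenbauerLead_ne_zero h0 h1 n
    have hq : (p - c • gegenbauer α n).degree < n := by
      rw [degree_lt_iff_coeff_zero]
      intro m hm
      rcases hm.eq_or_lt with rfl | hm
      · rw [coeff_sub, coeff_smul, gegenbauer_coeff_self, smul_eq_mul, div_mul_cancel₀ _ hne,
          sub_self]
      · rw [coeff_sub, coeff_smul, coeff_eq_zero_of_natDegree_lt
          ((gegenbauer_natDegree_le α n).trans_lt hm), (degree_lt_iff_coeff_zero _ _).1 hp m hm]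
        simp
    have := ih (fun k hk => hl k (by omega)) _ hq
    rw [map_sub, map_smul, hl n (by omega)] at this
    simpa using this

theorem gegenbauer_rec_eval (α : ℝ) (n : ℕ) (x : ℝ) :
    ((n : ℝ) + 2) * (gegenbauer α (n + 2)).eval x =
      2 * ((n : ℝ) + 1 + α) * x * (gegenbauer α (n + 1)).eval x
        - ((n : ℝ) + 2 * α) * (gegenbauer α n).eval x := by
  simpa using congrArg (eval x) (gegenbauer_rec α n)

theorem gegenbauer_first_order_eval (α : ℝ) (n : ℕ) (x : ℝ) :
    (1 - x ^ 2) * (derivative (gegenbauer α (n + 1))).eval x =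
      ((n : ℝ) + 2 * α) * (gegenbauer α n).eval x
        - ((n : ℝ) + 1) * x * (gegenbauer α (n + 1)).eval x := by
  simpa using congrArg (eval x) (gegenbauer_first_order α n)

theorem gegenbauer_ode_eval (α : ℝ) (n : ℕ) (x : ℝ) :
    (1 - x ^ 2) * (derivative (derivative (gegenbauer α n))).eval x
        - (2 * α + 1) * x * (derivative (gegenbauer α n)).eval x
        + (n : ℝ) * ((n : ℝ) + 2 * α) * (gegenbauer α n).eval x = 0 := by
  simpa using congrArg (eval x) (gegenbauer_ode α n)

/-! ### A uniform bound on `[-1, 1]` -/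

theorem abs_le_of_mul_eq {a b c d : ℝ} (hb : 0 < b) (h : b * c = a * d) (ha : |a| ≤ b) :
    |c| ≤ |d| := by
  have h1 : b * |c| ≤ b * |d| := by
    calc b * |c| = |b * c| := by rw [abs_mul, abs_of_pos hb]
      _ = |a| * |d| := by rw [h, abs_mul]
      _ ≤ b * |d| := by gcongr
  exact le_of_mul_le_mul_left h1 hb

/-- At an endpoint the first-order relation loses its derivative term and becomes a recursion with
ratio `x (n + 2α)/(n + 1)`, of modulus at most one. -/
theorem abs_gegenbauer_endpoint_le {α : ℝ} (h1 : -1 < 2 * α) (h2 : 2 * α < 1) {x : ℝ}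
    (hx : x ^ 2 = 1) (n : ℕ) : |(gegenbauer α n).eval x| ≤ 1 := by
  induction n with
  | zero => simp [gegenbauer]
  | succ n ih =>
    refine le_trans (abs_le_of_mul_eq (a := x * (n + 2 * α)) (b := n + 1) (by positivity) ?_ ?_) ih
    · have := gegenbauer_first_order_eval α n x
      rw [hx] at this
      linear_combination x * this - (n + 1) * (gegenbauer α (n + 1)).eval x * hx
    · have hx1 : |x| = 1 := by
        rw [← sq_abs] at hx
        nlinarith [abs_nonneg x]
      rw [abs_mul, hx1, one_mul, abs_le]
      have : (0 : ℝ) ≤ n := by positivity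
      constructor <;> linarith

theorem abs_gegenbauer_zero_le {α : ℝ} (h1 : -1 < 2 * α) (h2 : 2 * α < 1) (n : ℕ) :
    |(gegenbauer α n).eval 0| ≤ 1 := by
  induction n using Nat.twoStepInduction with
  | zero => simp [gegenbauer]
  | one => simp [gegenbauer]
  | more n ih _ =>
    refine le_trans (abs_le_of_mul_eq (a := -(n + 2 * α)) (b := n + 2) (by positivity) ?_ ?_) ih
    · have := gegenbauer_rec_eval α n 0
      linear_combination this
    · rw [abs_neg, abs_le]
      have : (0 : ℝ) ≤ n := by positivity
      constructor <;> linarith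

/-- Sonin's function, whose derivative is `4 α x C_n'(x)² / (n (n + 2 α))`. -/
noncomputable def sonin (α : ℝ) (n : ℕ) (x : ℝ) : ℝ :=
  n * (n + 2 * α) * (gegenbauer α n).eval x ^ 2
    + (1 - x ^ 2) * (derivative (gegenbauer α n)).eval x ^ 2

/-- The differential equation cancels every other term. The sign of `α x` then puts the maximum over
`[-1, 1]` at an endpoint if `α ≥ 0` and at `0` if `α ≤ 0`. -/
theorem hasDerivAt_sonin (α : ℝ) (n : ℕ) (x : ℝ) :
    HasDerivAt (sonin α n) (4 * α * x * (derivative (gegenbauer α n)).eval x ^ 2) x := by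
  have h1 := (gegenbauer α n).hasDerivAt x
  have h2 := (derivative (gegenbauer α n)).hasDerivAt x
  have h3 := ((h1.pow 2).const_mul (n * (n + 2 * α) : ℝ)).add
    ((((hasDerivAt_id x).pow 2).const_sub 1).mul (h2.pow 2))
  refine h3.congr_deriv ?_
  have := gegenbauer_ode_eval α n x
  simp only [id, Pi.pow_apply]
  push_cast
  linear_combination 2 * (derivative (gegenbauer α n)).eval x * this

theorem continuous_sonin (α : ℝ) (n : ℕ) : Continuous (sonin α n) :=
  continuous_iff_continuousAt.2 fun x => (hasDerivAt_sonin α n x).continuousAt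

theorem sonin_le_of_nonneg {α : ℝ} (hα : 0 ≤ α) (n : ℕ) {x : ℝ} (hx : x ∈ Icc (-1 : ℝ) 1) :
    sonin α n x ≤ sonin α n 1 ∨ sonin α n x ≤ sonin α n (-1) := by
  rcases le_total 0 x with h | h
  · left
    refine (monotoneOn_of_deriv_nonneg (convex_Icc 0 1) (continuous_sonin α n).continuousOn
      (fun y _ => (hasDerivAt_sonin α n y).differentiableAt.differentiableWithinAt) ?_)
      ⟨h, hx.2⟩ ⟨zero_le_one, le_rfl⟩ hx.2
    intro y hy
    rw [interior_Icc] at hy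
    rw [(hasDerivAt_sonin α n y).deriv]
    have := hy.1
    positivity
  · right
    refine (antitoneOn_of_deriv_nonpos (convex_Icc (-1) 0) (continuous_sonin α n).continuousOn
      (fun y _ => (hasDerivAt_sonin α n y).differentiableAt.differentiableWithinAt) ?_)
      ⟨le_rfl, by norm_num⟩ ⟨hx.1, h⟩ hx.1
    intro y hy
    rw [interior_Icc] at hy
    rw [(hasDerivAt_sonin α n y).deriv]
    have := mul_nonneg hα (neg_nonneg.2 hy.2.le)
    nlinarith [sq_nonneg ((derivative (gegenbauer α n)).eval y)]

theorem sonin_le_of_nonpos {α : ℝ} (hα : α ≤ 0) (n : ℕ) (x : ℝ) :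
    sonin α n x ≤ sonin α n 0 := by
  rcases le_total 0 x with h | h
  · refine (antitoneOn_of_deriv_nonpos (convex_Ici 0) (continuous_sonin α n).continuousOn
      (fun y _ => (hasDerivAt_sonin α n y).differentiableAt.differentiableWithinAt) ?_)
      self_mem_Ici h h
    intro y hy
    rw [interior_Ici] at hy
    rw [(hasDerivAt_sonin α n y).deriv]
    have := mul_nonneg (neg_nonneg.2 hα) (le_of_lt hy)
    nlinarith [sq_nonneg ((derivative (gegenbauer α n)).eval y)]
  · refine (monotoneOn_of_deriv_nonneg (convex_Iic 0) (continuous_sonin α n).continuousOn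
      (fun y _ => (hasDerivAt_sonin α n y).differentiableAt.differentiableWithinAt) ?_)
      h self_mem_Iic h
    intro y hy
    rw [interior_Iic] at hy
    rw [(hasDerivAt_sonin α n y).deriv]
    have := mul_nonneg (neg_nonneg.2 hα) (neg_nonneg.2 (le_of_lt hy))
    nlinarith [sq_nonneg ((derivative (gegenbauer α n)).eval y)]

/-- The Gegenbauer polynomials with `-1/2 < α < 1/2` are bounded on `[-1, 1]`, uniformly in the
degree. -/
theorem exists_abs_gegenbauer_le {α : ℝ} (h1 : -1 < 2 * α) (h2 : 2 * α < 1) :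
    ∃ M : ℝ, 0 < M ∧ ∀ n : ℕ, ∀ x ∈ Icc (-1 : ℝ) 1, |(gegenbauer α n).eval x| ≤ M := by
  -- The `1` bounds `C_n²` at the endpoints or at `0`; the fraction bounds the derivative term of
  -- Sonin's function at `0`, needed when `α ≤ 0`.
  set K : ℝ := 1 + 1 / (1 + 2 * α)
  have hpos : 0 < 1 + 2 * α := by linarith
  have hK : 1 ≤ K := by
    have : 0 ≤ 1 / (1 + 2 * α) := by positivity
    linarith
  have key : ∀ n : ℕ, ∀ x ∈ Icc (-1 : ℝ) 1, (gegenbauer α n).eval x ^ 2 ≤ K := by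
    intro n x hx
    cases n with
    | zero => simpa [gegenbauer] using hK
    | succ n =>
      have hn0 : (0 : ℝ) ≤ n := by positivity
      have hν : 0 < ((n : ℝ) + 1) * (n + 1 + 2 * α) := by
        apply mul_pos <;> linarith
      have hle : ((n : ℝ) + 1) * (n + 1 + 2 * α) * (gegenbauer α (n + 1)).eval x ^ 2 ≤
          sonin α (n + 1) x := by
        have : 0 ≤ (1 - x ^ 2) * (derivative (gegenbauer α (n + 1))).eval x ^ 2 :=
          mul_nonneg (by nlinarith [hx.1, hx.2]) (sq_nonneg _)
        simp only [sonin]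
        push_cast
        linarith
      have hend : ∀ y : ℝ, y ^ 2 = 1 → sonin α (n + 1) y ≤ ((n : ℝ) + 1) * (n + 1 + 2 * α) * K := by
        intro y hy
        have := abs_gegenbauer_endpoint_le h1 h2 hy (n + 1)
        rw [← sq_le_one_iff_abs_le_one] at this
        simp only [sonin, hy]
        push_cast
        nlinarith
      have hs : sonin α (n + 1) x ≤ ((n : ℝ) + 1) * (n + 1 + 2 * α) * K := by
        rcases le_total 0 α with h | h
        · rcases sonin_le_of_nonneg h (n + 1) hx with h | h
          · exact h.trans (hend 1 (by norm_num))
          · exact h.trans (hend (-1) (by norm_num))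
        · refine (sonin_le_of_nonpos h (n + 1) x).trans ?_
          have e1 := abs_gegenbauer_zero_le h1 h2 (n + 1)
          have e2 := abs_gegenbauer_zero_le h1 h2 n
          have e3 := gegenbauer_first_order_eval α n 0
          rw [← sq_le_one_iff_abs_le_one] at e1 e2
          have e4 : (derivative (gegenbauer α (n + 1))).eval 0 =
            ((n : ℝ) + 2 * α) * (gegenbauer α n).eval 0 := by linear_combination e3
          have e5 : ((n : ℝ) + 2 * α) ^ 2 * (gegenbauer α n).eval 0 ^ 2 ≤
              ((n : ℝ) + 1) * (n + 1 + 2 * α) * (1 / (1 + 2 * α)) := by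
            have f1 : ((n : ℝ) + 2 * α) ^ 2 * (gegenbauer α n).eval 0 ^ 2 ≤
              ((n : ℝ) + 2 * α) ^ 2 := mul_le_of_le_one_right (sq_nonneg _) e2
            refine f1.trans ?_
            rw [mul_one_div, le_div_iff₀ hpos]
            have f2 : ((n : ℝ) + 2 * α) ^ 2 ≤ (n + 1) ^ 2 := by
              apply sq_le_sq' <;> linarith
            have f3 : ((n : ℝ) + 1) * (1 + 2 * α) ≤ n + 1 + 2 * α := by nlinarith
            calc _ ≤ ((n : ℝ) + 1) ^ 2 * (1 + 2 * α) := by gcongr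
              _ = (n + 1) * ((n + 1) * (1 + 2 * α)) := by ring
              _ ≤ _ := by gcongr
          simp only [sonin, e4]
          push_cast
          have : ((n : ℝ) + 1) * (n + 1 + 2 * α) * (gegenbauer α (n + 1)).eval 0 ^ 2 ≤
              ((n : ℝ) + 1) * (n + 1 + 2 * α) := mul_le_of_le_one_right hν.le e1
          simp only [K]
          linarith
      exact le_of_mul_le_mul_left (hle.trans hs) hν
  -- As `K ≥ 1`, a bound `K` for the square also bounds the modulus.
  refine ⟨K, by linarith, fun n x hx => ?_⟩
  have := key n x hx
  rw [← sq_abs] at this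
  nlinarith [abs_nonneg ((gegenbauer α n).eval x)]

/-! ### The weight and the measure on `(-1, 1)` -/

/-- Lebesgue measure on `(-1, 1)`. -/
noncomputable abbrev muI : Measure ℝ := volume.restrict (Ioo (-1 : ℝ) 1)

/-- The Gegenbauer weight `(1 - y²)^{(s-1)/2}`. -/
noncomputable def weight (s y : ℝ) : ℝ := (1 - y ^ 2) ^ ((s - 1) / 2)

theorem integral_eq_muI (f : ℝ → ℝ) : ∫ y in (-1 : ℝ)..1, f y = ∫ y, f y ∂muI := by
  rw [intervalIntegral.integral_of_le (by norm_num), integral_Ioc_eq_integral_Ioo]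

theorem intervalIntegrable_iff_muI (f : ℝ → ℝ) :
    IntervalIntegrable f volume (-1) 1 ↔ Integrable f muI :=
  intervalIntegrable_iff_integrableOn_Ioo_of_le (by norm_num)

theorem one_sub_sq_pos {y : ℝ} (hy : y ∈ Ioo (-1 : ℝ) 1) : 0 < 1 - y ^ 2 := by
  nlinarith [hy.1, hy.2]

theorem weight_pos (s : ℝ) {y : ℝ} (hy : y ∈ Ioo (-1 : ℝ) 1) : 0 < weight s y :=
  Real.rpow_pos_of_pos (one_sub_sq_pos hy) _

theorem measurable_weight (s : ℝ) : Measurable (weight s) := by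
  unfold weight
  fun_prop

theorem ae_mem_Ioo : ∀ᵐ y ∂muI, y ∈ Ioo (-1 : ℝ) 1 := ae_restrict_mem measurableSet_Ioo

theorem continuousOn_weight (s : ℝ) : ContinuousOn (weight s) (Ioo (-1 : ℝ) 1) := by
  intro y hy
  refine ContinuousAt.continuousWithinAt ?_
  exact ContinuousAt.rpow_const (by fun_prop) (Or.inl (one_sub_sq_pos hy).ne')

theorem integrable_mul_continuousOn {f φ : ℝ → ℝ} (hf : Integrable f muI)
    (hφ : ContinuousOn φ (Icc (-1 : ℝ) 1)) : Integrable (fun y => f y * φ y) muI := by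
  obtain ⟨M, hM⟩ := isCompact_Icc.exists_bound_of_continuousOn hφ
  refine hf.mul_bdd (c := M)
    ((hφ.mono Ioo_subset_Icc_self).aestronglyMeasurable measurableSet_Ioo) ?_
  filter_upwards [ae_mem_Ioo] with y hy using hM y (Ioo_subset_Icc_self hy)

/-- This is the normalisation of the beta density, multiplied out. -/
theorem lintegral_beta {a b : ℝ} (ha : 0 < a) (hb : 0 < b) :
    ∫⁻ x in Ioo (0 : ℝ) 1, ENNReal.ofReal (x ^ (a - 1) * (1 - x) ^ (b - 1)) =
      ENNReal.ofReal (ProbabilityTheory.beta a b) := by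
  have h := ProbabilityTheory.lintegral_betaPDF_eq_one ha hb
  rw [ProbabilityTheory.lintegral_betaPDF] at h
  have hpos := ProbabilityTheory.beta_pos ha hb
  have h2 : ∀ x : ℝ, ENNReal.ofReal (1 / ProbabilityTheory.beta a b * x ^ (a - 1) *
      (1 - x) ^ (b - 1)) = ENNReal.ofReal (1 / ProbabilityTheory.beta a b) *
        ENNReal.ofReal (x ^ (a - 1) * (1 - x) ^ (b - 1)) := fun x => by
    rw [mul_assoc, ENNReal.ofReal_mul (by positivity)]
  simp_rw [h2] at h
  rw [lintegral_const_mul _ (by fun_prop)] at h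
  calc _ = ENNReal.ofReal (ProbabilityTheory.beta a b) *
      (ENNReal.ofReal (1 / ProbabilityTheory.beta a b) * _) := by
        rw [← mul_assoc, ← ENNReal.ofReal_mul hpos.le, mul_one_div_cancel hpos.ne',
          ENNReal.ofReal_one, one_mul]
    _ = _ := by rw [h, mul_one]

theorem lintegral_weight {s : ℝ} (hs : -1 < s) :
    ∫⁻ y in Ioo (-1 : ℝ) 1, ENNReal.ofReal (weight s y) =
      ENNReal.ofReal (2 ^ s * ProbabilityTheory.beta ((s + 1) / 2) ((s + 1) / 2)) := by
  have himg : (fun v : ℝ => 2 * v - 1) '' Ioo 0 1 = Ioo (-1) 1 := by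
    ext y
    constructor
    · rintro ⟨v, hv, rfl⟩
      exact ⟨by dsimp only; linarith [hv.1], by dsimp only; linarith [hv.2]⟩
    · intro hy
      exact ⟨(y + 1) / 2, ⟨by linarith [hy.1], by linarith [hy.2]⟩, by ring⟩
  have hd : ∀ v ∈ Ioo (0 : ℝ) 1,
      HasDerivWithinAt (fun v : ℝ => 2 * v - 1) ((fun _ => 2) v) (Ioo 0 1) v := fun v _ => by
    simpa using (((hasDerivAt_id v).const_mul 2).sub_const 1).hasDerivWithinAt
  rw [← himg, lintegral_image_eq_lintegral_abs_deriv_mul measurableSet_Ioo hd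
    (fun x _ y _ h => by simpa using h)]
  have hp : (0 : ℝ) < (s + 1) / 2 := by linarith
  rw [ENNReal.ofReal_mul (by positivity), ← lintegral_beta hp hp,
    ← lintegral_const_mul _ (by fun_prop)]
  refine setLIntegral_congr_fun measurableSet_Ioo fun v hv => ?_
  have h1 : 0 < v := hv.1
  have h2 : 0 < 1 - v := sub_pos.2 hv.2
  rw [← ENNReal.ofReal_mul (by positivity), ← ENNReal.ofReal_mul (by positivity)]
  congr 1
  have e : (1 : ℝ) - (2 * v - 1) ^ 2 = 2 ^ (2 : ℝ) * (v * (1 - v)) := by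
    rw [Real.rpow_two]; ring
  rw [weight, e, Real.mul_rpow (by positivity) (by positivity), Real.mul_rpow h1.le h2.le,
    ← Real.rpow_mul (by norm_num)]
  have e2 : (2 : ℝ) ^ s = 2 * 2 ^ (2 * ((s - 1) / 2)) := by
    rw [show s = 1 + 2 * ((s - 1) / 2) by ring, Real.rpow_add (by norm_num), Real.rpow_one]
    ring_nf
  have e3 : (s + 1) / 2 - 1 = (s - 1) / 2 := by ring
  rw [e2, e3, abs_of_pos (by norm_num : (0 : ℝ) < 2)]
  ring

/-- Lets substitutions be done on lower integrals, where no integrability is needed, and yields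
integrability and value together. -/
theorem integral_eq_of_lintegral_ofReal {f : ℝ → ℝ} {c : ℝ} (hf : Measurable f)
    (hpos : ∀ y ∈ Ioo (-1 : ℝ) 1, 0 ≤ f y) (hc : 0 ≤ c)
    (h : ∫⁻ y in Ioo (-1 : ℝ) 1, ENNReal.ofReal (f y) = ENNReal.ofReal c) :
    Integrable f muI ∧ ∫ y, f y ∂muI = c := by
  have hp : 0 ≤ᵐ[muI] f := by
    filter_upwards [ae_mem_Ioo] with y hy using hpos y hy
  constructor
  · refine ⟨hf.aestronglyMeasurable, ?_⟩
    rw [hasFiniteIntegral_iff_ofReal hp, h]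
    exact ENNReal.ofReal_lt_top
  · rw [integral_eq_lintegral_of_nonneg_ae hp hf.aestronglyMeasurable, h, ENNReal.toReal_ofReal hc]

theorem integrable_weight {s : ℝ} (hs : -1 < s) : Integrable (weight s) muI :=
  (integral_eq_of_lintegral_ofReal (measurable_weight s) (fun _ hy => (weight_pos s hy).le)
    (mul_nonneg (by positivity)
      (ProbabilityTheory.beta_pos (by linarith) (by linarith)).le) (lintegral_weight hs)).1

/-- Legendre's duplication formula turns the beta value into `h_0`. -/
theorem integral_weight {s : ℝ} (hs : -1 < s) (hs0 : s ≠ 0) :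
    ∫ y, weight s y ∂muI = gegenbauerNorm s 0 := by
  have hp : (0 : ℝ) < (s + 1) / 2 := by linarith
  rw [(integral_eq_of_lintegral_ofReal (measurable_weight s) (fun _ hy => (weight_pos s hy).le)
    (mul_nonneg (by positivity)
      (ProbabilityTheory.beta_pos (by linarith) (by linarith)).le) (lintegral_weight hs)).2]
  have hG1 : Real.Gamma (s + 1) ≠ 0 := (Real.Gamma_pos_of_pos (by linarith)).ne'
  have hGs : Real.Gamma s ≠ 0 := by
    rw [Real.Gamma_add_one hs0] at hG1
    exact right_ne_zero_of_mul hG1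
  have hGh : Real.Gamma (s / 2) ≠ 0 := by
    have h1 : Real.Gamma (s / 2 + 1) ≠ 0 := (Real.Gamma_pos_of_pos (by linarith)).ne'
    rw [Real.Gamma_add_one (by positivity)] at h1
    exact right_ne_zero_of_mul h1
  have hd := Real.Gamma_mul_Gamma_add_half (s / 2)
  rw [show 2 * (s / 2) = s by ring, show s / 2 + 1 / 2 = (s + 1) / 2 by ring] at hd
  have hπ : √Real.pi ^ 2 = Real.pi := Real.sq_sqrt Real.pi_pos.le
  have h2 : (2 : ℝ) ^ s * 2 ^ (1 - s) = 2 := by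
    rw [← Real.rpow_add (by norm_num)]; simp
  have hd2 : Real.Gamma (s / 2) ^ 2 * Real.Gamma ((s + 1) / 2) ^ 2 =
      Real.Gamma s ^ 2 * (2 ^ (1 - s)) ^ 2 * Real.pi := by
    rw [← mul_pow, hd, mul_pow, mul_pow, hπ]
  rw [ProbabilityTheory.beta, gegenbauerNorm, show (s + 1) / 2 + (s + 1) / 2 = s + 1 by ring,
    Real.Gamma_add_one hs0]
  simp only [Nat.cast_zero, zero_add, Nat.factorial_zero, Nat.cast_one, one_mul]
  field_simp
  have h3 : (2 : ℝ) ^ s * (2 ^ (1 - s)) ^ 2 = 2 * 2 ^ (1 - s) := by rw [sq, ← mul_assoc, h2]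
  linear_combination 2 ^ s * hd2 + Real.Gamma s ^ 2 * Real.pi * h3

/-- The integral of a total derivative with weight `(1 - y²)^{(s+1)/2}` vanishes. -/
theorem integral_weight_deriv_eq_zero {s : ℝ} (hs : -1 < s) {g g' : ℝ → ℝ}
    (hg : ContinuousOn g (Icc (-1 : ℝ) 1)) (hg' : ContinuousOn g' (Icc (-1 : ℝ) 1))
    (hd : ∀ y ∈ Ioo (-1 : ℝ) 1, HasDerivAt g (g' y) y) :
    ∫ y, weight s y * ((1 - y ^ 2) * g' y - (s + 1) * y * g y) ∂muI = 0 := by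
  have hp : (0 : ℝ) < (s + 1) / 2 := by linarith
  have hint : Integrable (fun y => weight s y * ((1 - y ^ 2) * g' y - (s + 1) * y * g y)) muI :=
    integrable_mul_continuousOn (integrable_weight hs) (by fun_prop)
  rw [← integral_eq_muI, intervalIntegral.integral_eq_sub_of_hasDerivAt_of_le
    (f := fun y => (1 - y ^ 2) ^ ((s + 1) / 2) * g y) (by norm_num) ?_ ?_
    ((intervalIntegrable_iff_muI _).2 hint)]
  · simp [Real.zero_rpow hp.ne']
  · refine ContinuousOn.mul ?_ hg
    exact ContinuousOn.rpow_const (by fun_prop) fun _ _ => Or.inr hp.le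
  · intro y hy
    have hpos := one_sub_sq_pos hy
    have h1 : HasDerivAt (fun y : ℝ => 1 - y ^ 2) (-(2 * y)) y := by
      simpa using ((hasDerivAt_id y).pow 2).const_sub 1
    refine ((h1.rpow_const (p := (s + 1) / 2) (Or.inl hpos.ne')).mul (hd y hy)).congr_deriv ?_
    have e : (1 - y ^ 2) ^ ((s + 1) / 2) = (1 - y ^ 2) ^ ((s - 1) / 2) * (1 - y ^ 2) := by
      rw [← Real.rpow_add_one hpos.ne']; ring_nf
    rw [weight, e, show (s + 1) / 2 - 1 = (s - 1) / 2 by ring]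
    ring

/-! ### Orthogonality and norms -/

/-- The pairing `p ↦ ∫ f p` of an integrable function with polynomials. -/
noncomputable def polyPairing (f : ℝ → ℝ) (hf : Integrable f muI) : ℝ[X] →ₗ[ℝ] ℝ where
  toFun p := ∫ y, f y * p.eval y ∂muI
  map_add' p q := by
    rw [← integral_add (integrable_mul_continuousOn hf p.continuousOn)
      (integrable_mul_continuousOn hf q.continuousOn)]
    simp [mul_add]
  map_smul' c p := by
    rw [RingHom.id_apply, smul_eq_mul, ← integral_const_mul]
    congr 1
    ext y
    simp only [eval_smul, smul_eq_mul]
    ring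

theorem polyPairing_apply {f : ℝ → ℝ} (hf : Integrable f muI) (p : ℝ[X]) :
    polyPairing f hf p = ∫ y, f y * p.eval y ∂muI := rfl

/-- Green's formula for the Gegenbauer operator, against `C_n`. -/
theorem integral_weight_gegenbauer_operator {s : ℝ} (hs : -1 < s) {v v' v'' : ℝ → ℝ}
    (hv : ContinuousOn v (Icc (-1 : ℝ) 1)) (hv' : ContinuousOn v' (Icc (-1 : ℝ) 1))
    (hv'' : ContinuousOn v'' (Icc (-1 : ℝ) 1))
    (hd : ∀ y ∈ Ioo (-1 : ℝ) 1, HasDerivAt v (v' y) y)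
    (hd' : ∀ y ∈ Ioo (-1 : ℝ) 1, HasDerivAt v' (v'' y) y) (n : ℕ) :
    n * (n + s) * ∫ y, weight s y * ((gegenbauer (s / 2) n).eval y * v y) ∂muI =
      -∫ y, weight s y * ((gegenbauer (s / 2) n).eval y *
        ((1 - y ^ 2) * v'' y - (s + 1) * y * v' y)) ∂muI := by
  set G := gegenbauer (s / 2) n with hG
  have hc : ∀ p : ℝ[X], ContinuousOn (fun y => p.eval y) (Icc (-1 : ℝ) 1) := fun p => p.continuousOn
  have h0 := hc G
  have h1 := hc (derivative G)
  have h2 := hc (derivative (derivative G))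
  -- The total derivative used is that of the weighted Wronskian of `G` and `v`.
  have key := integral_weight_deriv_eq_zero hs
    (g := fun y => G.eval y * v' y - (derivative G).eval y * v y)
    (g' := fun y => G.eval y * v'' y - (derivative (derivative G)).eval y * v y)
    (by fun_prop) (by fun_prop) (fun y hy => by
      refine (((G.hasDerivAt y).mul (hd' y hy)).sub
        (((derivative G).hasDerivAt y).mul (hd y hy))).congr_deriv ?_
      ring)
  rw [eq_neg_iff_add_eq_zero, ← integral_const_mul, ← integral_add, ← key]
  · refine integral_congr_ae (Filter.Eventually.of_forall fun y => ?_)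
    have := gegenbauer_ode_eval (s / 2) n y
    rw [← hG] at this
    simp only
    linear_combination weight s y * v y * this
  · exact (integrable_mul_continuousOn (integrable_weight hs) (by fun_prop)).const_mul _
  · exact integrable_mul_continuousOn (integrable_weight hs) (by fun_prop)

/-- Eigenfunctions of the symmetric Gegenbauer operator: the eigenvalues differ by `(n - m)(n + m +
s)`, nonzero since `n + m ≥ 1`. -/
theorem integral_weight_gegenbauer_mul {s : ℝ} (hs : -1 < s) {m n : ℕ} (hmn : m ≠ n) :
    ∫ y, weight s y * ((gegenbauer (s / 2) n).eval y * (gegenbauer (s / 2) m).eval y) ∂muI = 0 := by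
  set G := gegenbauer (s / 2) m with hG
  have hc : ∀ p : ℝ[X], ContinuousOn (fun y => p.eval y) (Icc (-1 : ℝ) 1) := fun p => p.continuousOn
  have key := integral_weight_gegenbauer_operator hs (hc G) (hc (derivative G))
    (hc (derivative (derivative G))) (fun y _ => G.hasDerivAt y)
    (fun y _ => (derivative G).hasDerivAt y) n
  have h2 : ∀ y : ℝ, weight s y * ((gegenbauer (s / 2) n).eval y *
      ((1 - y ^ 2) * (derivative (derivative G)).eval y - (s + 1) * y * (derivative G).eval y)) =
      -(m * (m + s)) * (weight s y * ((gegenbauer (s / 2) n).eval y * G.eval y)) := fun y => by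
    have := gegenbauer_ode_eval (s / 2) m y
    rw [← hG] at this
    linear_combination weight s y * (gegenbauer (s / 2) n).eval y * this
  simp_rw [h2] at key
  rw [integral_const_mul] at key
  set J := ∫ y, weight s y * ((gegenbauer (s / 2) n).eval y * G.eval y) ∂muI
  have h3 : ((n : ℝ) - m) * (n + m + s) * J = 0 := by linear_combination key
  have h4 : (n : ℝ) - m ≠ 0 := by
    rw [sub_ne_zero]; exact_mod_cast hmn.symm
  have h5 : (n : ℝ) + m + s ≠ 0 := by
    have : (1 : ℝ) ≤ n + m := by
      have : 1 ≤ n + m := by omega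
      exact_mod_cast this
    linarith
  simpa [h4, h5] using h3

theorem gegenbauerNorm_succ {s : ℝ} (hs : -1 < s) (hs0 : s ≠ 0) (n : ℕ) :
    (n + 1) * (n + 1 + s / 2) * gegenbauerNorm s (n + 1) =
      (n + s / 2) * (n + s) * gegenbauerNorm s n := by
  have h1 : (n : ℝ) + s ≠ 0 := by
    rcases Nat.eq_zero_or_pos n with rfl | hn
    · simpa using hs0
    · have : (1 : ℝ) ≤ n := by exact_mod_cast hn
      linarith
  have h2 : (n : ℝ) + s / 2 ≠ 0 := by
    rcases Nat.eq_zero_or_pos n with rfl | hn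
    · simpa using hs0
    · have : (1 : ℝ) ≤ n := by exact_mod_cast hn
      linarith
  have h3 : (n : ℝ) + 1 + s / 2 ≠ 0 := by
    have : (0 : ℝ) ≤ n := by positivity
    linarith
  have hGh : Real.Gamma (s / 2) ≠ 0 := by
    have h1 : Real.Gamma (s / 2 + 1) ≠ 0 := (Real.Gamma_pos_of_pos (by linarith)).ne'
    rw [Real.Gamma_add_one (by positivity)] at h1
    exact right_ne_zero_of_mul h1
  have h4 : (n : ℝ) + 1 ≠ 0 := by positivity
  have h5 : (n.factorial : ℝ) ≠ 0 := by positivity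
  rw [gegenbauerNorm, gegenbauerNorm, Nat.factorial_succ]
  push_cast
  rw [show (n : ℝ) + 1 + s = n + s + 1 by ring, Real.Gamma_add_one h1]
  have h6 : (n : ℝ) * 2 + s ≠ 0 := fun h => h2 (by linarith)
  have h7 : ((n : ℝ) + 1) * 2 + s ≠ 0 := fun h => h3 (by linarith)
  field_simp

theorem gegenbauerNorm_pos {s : ℝ} (hs : -1 < s) (hs0 : s ≠ 0) (n : ℕ) :
    0 < gegenbauerNorm s n := by
  cases n with
  | zero =>
    -- For `s < 0` both `Γ(s)` and `s/2` in `h_0` are negative; positivity is read off the integral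
    -- instead.
    rw [← integral_weight hs hs0, integral_pos_iff_support_of_nonneg_ae _ (integrable_weight hs)]
    · have : Ioo (-1 : ℝ) 1 ⊆ Function.support (weight s) := fun y hy => (weight_pos s hy).ne'
      rw [Measure.restrict_apply' measurableSet_Ioo, inter_eq_right.2 this]
      simp
    · filter_upwards [ae_mem_Ioo] with y hy using (weight_pos s hy).le
  | succ n =>
    rw [gegenbauerNorm]
    have h0 : (0 : ℝ) ≤ n := by positivity
    have hG : Real.Gamma (s / 2) ≠ 0 := by
      have h1 : Real.Gamma (s / 2 + 1) ≠ 0 := (Real.Gamma_pos_of_pos (by linarith)).ne'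
      rw [Real.Gamma_add_one (by positivity)] at h1
      exact right_ne_zero_of_mul h1
    push_cast
    have h1 : 0 < Real.Gamma (n + 1 + s) := Real.Gamma_pos_of_pos (by linarith)
    have h2 : 0 < (n : ℝ) + 1 + s / 2 := by linarith
    have := Real.pi_pos
    have h3 : 0 < Real.Gamma (s / 2) ^ 2 := by positivity
    positivity

/-- Pairing two consecutive recurrences with `C_n` and `C_{n+1}` evaluates `∫ w x C_{n+1} C_n` in
two ways, which gives the ratio of successive norms. -/
theorem integral_weight_gegenbauer_sq {s : ℝ} (hs : -1 < s) (hs0 : s ≠ 0) (n : ℕ) :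
    ∫ y, weight s y * ((gegenbauer (s / 2) n).eval y * (gegenbauer (s / 2) n).eval y) ∂muI =
      gegenbauerNorm s n := by
  induction n with
  | zero => simp [gegenbauer, integral_weight hs hs0]
  | succ n ih =>
    set l := polyPairing (weight s) (integrable_weight hs)
    have hl : ∀ i j : ℕ, ∫ y, weight s y * ((gegenbauer (s / 2) i).eval y *
        (gegenbauer (s / 2) j).eval y) ∂muI = l (gegenbauer (s / 2) i * gegenbauer (s / 2) j) :=
      fun i j => by simp [l, polyPairing_apply]
    have h1 : ((n : ℝ) + 2) * l (gegenbauer (s / 2) (n + 2) * gegenbauer (s / 2) n) =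
        2 * ((n : ℝ) + 1 + s / 2) * l (X * gegenbauer (s / 2) (n + 1) * gegenbauer (s / 2) n)
          - (n + s) * l (gegenbauer (s / 2) n * gegenbauer (s / 2) n) := by
      simp only [← smul_eq_mul (a := ((n : ℝ) + 2)), ← smul_eq_mul (a := ((n : ℝ) + s)),
        ← smul_eq_mul (a := 2 * ((n : ℝ) + 1 + s / 2)), ← map_smul, ← map_sub]
      congr 1
      refine Polynomial.funext fun x => ?_
      have := gegenbauer_rec_eval (s / 2) n x
      simp only [eval_smul, eval_mul, eval_sub, eval_X, smul_eq_mul]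
      linear_combination (gegenbauer (s / 2) n).eval x * this
    have h2 : ((n : ℝ) + 1) * l (gegenbauer (s / 2) (n + 1) * gegenbauer (s / 2) (n + 1)) =
        2 * ((n : ℝ) + s / 2) * l (X * gegenbauer (s / 2) (n + 1) * gegenbauer (s / 2) n) := by
      cases n with
      | zero =>
        simp only [← smul_eq_mul (a := (((0 : ℕ) : ℝ) + 1)),
          ← smul_eq_mul (a := 2 * (((0 : ℕ) : ℝ) + s / 2)), ← map_smul]
        congr 1
        refine Polynomial.funext fun x => ?_
        simp [gegenbauer]
        ring
      | succ m =>
        have h3 : (((m + 1 : ℕ) : ℝ) + 1) *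
            l (gegenbauer (s / 2) (m + 1 + 1) * gegenbauer (s / 2) (m + 1 + 1)) =
          2 * (((m + 1 : ℕ) : ℝ) + s / 2) *
              l (X * gegenbauer (s / 2) (m + 1 + 1) * gegenbauer (s / 2) (m + 1))
            - (m + s) * l (gegenbauer (s / 2) m * gegenbauer (s / 2) (m + 2)) := by
          simp only [← smul_eq_mul (a := (((m + 1 : ℕ) : ℝ) + 1)), ← smul_eq_mul (a := ((m : ℝ) + s)),
            ← smul_eq_mul (a := 2 * (((m + 1 : ℕ) : ℝ) + s / 2)), ← map_smul, ← map_sub]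
          congr 1
          refine Polynomial.funext fun x => ?_
          have := gegenbauer_rec_eval (s / 2) m x
          simp only [eval_smul, eval_mul, eval_sub, eval_X, smul_eq_mul]
          push_cast
          linear_combination (gegenbauer (s / 2) (m + 2)).eval x * this
        rw [h3, ← hl m (m + 2), integral_weight_gegenbauer_mul hs (by omega), mul_zero, sub_zero]
    rw [hl] at ih ⊢
    rw [← hl (n + 2) n, integral_weight_gegenbauer_mul hs (by omega), ih] at h1
    have h4 := gegenbauerNorm_succ hs hs0 n
    have h0 : (0 : ℝ) ≤ n := by positivity
    have h5 : ((n : ℝ) + 1) * (n + 1 + s / 2) ≠ 0 :=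
      (mul_pos (by linarith) (by linarith)).ne'
    apply mul_left_cancel₀ h5
    rw [h4]
    linear_combination (n + 1 + s / 2) * h2 - (n + s / 2) * h1

/-! ### The kernel `|x - y|^{-s}` integrated against the weight -/

theorem lintegral_Ioo_eq_mul_left {f : ℝ → ENNReal} (hf : ∀ t, f (-t) = f t) :
    ∫⁻ t in Ioo (-1 : ℝ) 1, f t = 2 * ∫⁻ t in Ioo (0 : ℝ) 1, f t := by
  rw [← Ioo_union_Ico_eq_Ioo (a := (-1 : ℝ)) (b := 0) (c := 1) (by norm_num) (by norm_num),
    lintegral_union measurableSet_Ico (by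
      rw [Set.disjoint_left]; intro y hy hy'; exact absurd hy.2 (not_lt.2 hy'.1)),
    two_mul, setLIntegral_congr Ioo_ae_eq_Ico.symm]
  congr 1
  have himg : (fun v : ℝ => -v) '' Ioo 0 1 = Ioo (-1) 0 := by simp
  have hd : ∀ v ∈ Ioo (0 : ℝ) 1,
      HasDerivWithinAt (fun v : ℝ => -v) ((fun _ => -1) v) (Ioo 0 1) v := fun v _ =>
    (hasDerivAt_neg v).hasDerivWithinAt
  rw [← himg, lintegral_image_eq_lintegral_abs_deriv_mul measurableSet_Ioo hd
    (fun x _ y _ h => by simpa using h)]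
  simp [hf]

theorem lintegral_Ioo_comp_neg (f : ℝ → ENNReal) :
    ∫⁻ t in Ioo (-1 : ℝ) 1, f (-t) = ∫⁻ t in Ioo (-1 : ℝ) 1, f t := by
  have himg : (fun v : ℝ => -v) '' Ioo (-1) 1 = Ioo (-1) 1 := by simp
  have hd : ∀ v ∈ Ioo (-1 : ℝ) 1,
      HasDerivWithinAt (fun v : ℝ => -v) ((fun _ => -1) v) (Ioo (-1) 1) v := fun v _ =>
    (hasDerivAt_neg v).hasDerivWithinAt
  conv_rhs => rw [← himg]
  rw [lintegral_image_eq_lintegral_abs_deriv_mul measurableSet_Ioo hd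
    (fun x _ y _ h => by simpa using h)]
  simp

theorem one_add_mul_pos {x t : ℝ} (hx : x ∈ Ioo (-1 : ℝ) 1) (ht : t ∈ Ioo (-1 : ℝ) 1) :
    0 < 1 + x * t := by
  nlinarith [mul_pos (sub_pos.2 hx.2) (sub_pos.2 ht.2),
    mul_pos (by linarith [hx.1] : 0 < 1 + x) (by linarith [ht.1] : 0 < 1 + t)]

/-- The substitution `y = (x + t)/(1 + x t)` preserves the interval and moves the singularity to `t
= 0`; the powers of `1 + x t` collapse to a single one. -/
theorem lintegral_kernel_weight_mobius (s : ℝ) {x : ℝ} (hx : x ∈ Ioo (-1 : ℝ) 1) :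
    ∫⁻ y in Ioo (-1 : ℝ) 1, ENNReal.ofReal (|x - y| ^ (-s) * weight s y) =
      ∫⁻ t in Ioo (-1 : ℝ) 1, ENNReal.ofReal
        ((1 - x ^ 2) ^ ((1 - s) / 2) * |t| ^ (-s) * weight s t / (1 + x * t)) := by
  have hA := one_sub_sq_pos hx
  have hD : ∀ t ∈ Ioo (-1 : ℝ) 1, 0 < 1 + x * t := fun t ht => one_add_mul_pos hx ht
  have himg : (fun t : ℝ => (x + t) / (1 + x * t)) '' Ioo (-1) 1 = Ioo (-1) 1 := by
    ext y
    constructor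
    · rintro ⟨t, ht, rfl⟩
      have := hD t ht
      constructor
      · rw [lt_div_iff₀ this]
        nlinarith [mul_pos (by linarith [hx.1] : 0 < 1 + x) (by linarith [ht.1] : 0 < 1 + t)]
      · rw [div_lt_iff₀ this]
        nlinarith [mul_pos (sub_pos.2 hx.2) (sub_pos.2 ht.2)]
    · intro hy
      have h1 : 0 < 1 - x * y := by
        have := hD (-y) ⟨by linarith [hy.2], by linarith [hy.1]⟩
        linarith
      refine ⟨(y - x) / (1 - x * y), ⟨?_, ?_⟩, ?_⟩
      · rw [lt_div_iff₀ h1]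
        nlinarith [mul_pos (sub_pos.2 hx.2) (by linarith [hy.1] : 0 < 1 + y)]
      · rw [div_lt_iff₀ h1]
        nlinarith [mul_pos (by linarith [hx.1] : 0 < 1 + x) (sub_pos.2 hy.2)]
      · have e1 : x + (y - x) / (1 - x * y) = y * (1 - x ^ 2) / (1 - x * y) := by
          field_simp; ring
        have e2 : 1 + x * ((y - x) / (1 - x * y)) = (1 - x ^ 2) / (1 - x * y) := by
          field_simp; ring
        simp only [e1, e2]
        rw [div_div_div_cancel_right₀ h1.ne', mul_div_cancel_right₀ _ hA.ne']
  have hd : ∀ t ∈ Ioo (-1 : ℝ) 1, HasDerivWithinAt (fun t : ℝ => (x + t) / (1 + x * t))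
      ((fun t => (1 - x ^ 2) / (1 + x * t) ^ 2) t) (Ioo (-1) 1) t := fun t ht => by
    have := hD t ht
    refine HasDerivAt.hasDerivWithinAt ?_
    refine (((hasDerivAt_id t).const_add x).div
      (((hasDerivAt_id t).const_mul x).const_add 1) this.ne').congr_deriv ?_
    simp only [id]
    congr 1
    ring
  have hinj : InjOn (fun t : ℝ => (x + t) / (1 + x * t)) (Ioo (-1) 1) := by
    intro t ht t' ht' h
    have h1 := hD t ht
    have h2 := hD t' ht'
    simp only at h
    rw [div_eq_div_iff h1.ne' h2.ne'] at h
    have : (1 - x ^ 2) * (t - t') = 0 := by linear_combination h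
    rcases mul_eq_zero.1 this with h3 | h3
    · exact absurd h3 hA.ne'
    · linarith
  conv_lhs => rw [← himg]
  rw [lintegral_image_eq_lintegral_abs_deriv_mul measurableSet_Ioo hd hinj]
  refine setLIntegral_congr_fun measurableSet_Ioo fun t ht => ?_
  have h1 := hD t ht
  have hB := one_sub_sq_pos ht
  rw [← ENNReal.ofReal_mul (by positivity)]
  congr 1
  have e1 : x - (x + t) / (1 + x * t) = -(t * (1 - x ^ 2) / (1 + x * t)) := by
    field_simp; ring
  have e2 : 1 - ((x + t) / (1 + x * t)) ^ 2 =
      (1 - x ^ 2) * (1 - t ^ 2) / (1 + x * t) ^ (2 : ℝ) := by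
    rw [Real.rpow_two]
    field_simp; ring
  generalize hAA : 1 - x ^ 2 = A at *
  generalize hDD : 1 + x * t = D at *
  rw [abs_of_pos (show 0 < A / D ^ 2 by positivity), e1, abs_neg, abs_div, abs_mul, abs_of_pos hA,
    abs_of_pos h1,
    Real.div_rpow (by positivity) h1.le, Real.mul_rpow (abs_nonneg _) hA.le, weight, e2,
    Real.div_rpow (by positivity) (by positivity), Real.mul_rpow hA.le hB.le,
    ← Real.rpow_mul h1.le, weight]
  have f1 : A ^ ((1 - s) / 2) = A * A ^ (-s) * A ^ ((s - 1) / 2) := by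
    rw [show (1 - s) / 2 = 1 + -s + (s - 1) / 2 by ring, Real.rpow_add hA, Real.rpow_add hA,
      Real.rpow_one]
  have f2 : D ^ (-s) * D ^ (2 * ((s - 1) / 2)) = D⁻¹ := by
    rw [← Real.rpow_add h1, ← Real.rpow_neg_one]
    ring_nf
  have f3 : D ^ (-s) ≠ 0 := (Real.rpow_pos_of_pos h1 _).ne'
  have f4 : D ^ (2 * ((s - 1) / 2)) ≠ 0 := (Real.rpow_pos_of_pos h1 _).ne'
  rw [f1]
  calc _ = A * A ^ (-s) * A ^ ((s - 1) / 2) * |t| ^ (-s) * (1 - t ^ 2) ^ ((s - 1) / 2) /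
        (D ^ 2 * (D ^ (-s) * D ^ (2 * ((s - 1) / 2)))) := by
        field_simp
    _ = _ := by
        rw [f2]
        field_simp

/-- Average the previous integrand over `t` and `-t`. -/
theorem lintegral_kernel_weight_even (s : ℝ) {x : ℝ} (hx : x ∈ Ioo (-1 : ℝ) 1) :
    ∫⁻ y in Ioo (-1 : ℝ) 1, ENNReal.ofReal (|x - y| ^ (-s) * weight s y) =
      ∫⁻ t in Ioo (-1 : ℝ) 1, ENNReal.ofReal
        ((1 - x ^ 2) ^ ((1 - s) / 2) * |t| ^ (-s) * weight s t / (1 - x ^ 2 * t ^ 2)) := by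
  have hA := one_sub_sq_pos hx
  set F : ℝ → ENNReal := fun t => ENNReal.ofReal
    ((1 - x ^ 2) ^ ((1 - s) / 2) * |t| ^ (-s) * weight s t / (1 + x * t)) with hF
  have hFm : Measurable F := by
    have := measurable_weight s
    fun_prop
  have h1 : ∫⁻ y in Ioo (-1 : ℝ) 1, ENNReal.ofReal (|x - y| ^ (-s) * weight s y) =
    ∫⁻ t in Ioo (-1 : ℝ) 1, F t := lintegral_kernel_weight_mobius s hx
  have h2 : 2 * ∫⁻ t in Ioo (-1 : ℝ) 1, F t =
      2 * ∫⁻ t in Ioo (-1 : ℝ) 1, ENNReal.ofReal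
        ((1 - x ^ 2) ^ ((1 - s) / 2) * |t| ^ (-s) * weight s t / (1 - x ^ 2 * t ^ 2)) := by
    conv_lhs => rw [two_mul, ← lintegral_Ioo_comp_neg F, lintegral_Ioo_comp_neg F]
    conv_lhs =>
      enter [2]
      rw [← lintegral_Ioo_comp_neg F]
    have hm : Measurable fun t => ENNReal.ofReal
        ((1 - x ^ 2) ^ ((1 - s) / 2) * |t| ^ (-s) * weight s t / (1 - x ^ 2 * t ^ 2)) := by
      have := measurable_weight s
      fun_prop
    rw [← lintegral_add_left hFm, ← lintegral_const_mul _ hm]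
    refine setLIntegral_congr_fun measurableSet_Ioo fun t ht => ?_
    have hw := weight_pos s ht
    have g1 : 0 < 1 + x * t := one_add_mul_pos hx ht
    have g2 : 0 < 1 - x * t := by
      have := one_add_mul_pos hx (t := -t) ⟨by linarith [ht.2], by linarith [ht.1]⟩
      linarith
    have g3 : 1 - x ^ 2 * t ^ 2 = (1 + x * t) * (1 - x * t) := by ring
    have g4 : weight s (-t) = weight s t := by simp [weight]
    have g5 : 1 + x * -t = 1 - x * t := by ring
    simp only [hF, g4, abs_neg, g5, g3]
    rw [← ENNReal.ofReal_add (by positivity) (by positivity),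
      ← ENNReal.ofReal_ofNat, ← ENNReal.ofReal_mul (by positivity)]
    congr 1
    field_simp
    ring
  rw [h1]
  exact (ENNReal.mul_right_inj (by norm_num) (by norm_num)).1 h2

/-- The substitution `y = t √(1 - x²) / √(1 - x² t²)`, applied to the right side, produces exactly
the symmetrised integrand. -/
theorem lintegral_kernel_weight_eq_zero (s : ℝ) {x : ℝ} (hx : x ∈ Ioo (-1 : ℝ) 1) :
    ∫⁻ y in Ioo (-1 : ℝ) 1, ENNReal.ofReal (|x - y| ^ (-s) * weight s y) =
      ∫⁻ y in Ioo (-1 : ℝ) 1, ENNReal.ofReal (|y| ^ (-s) * weight s y) := by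
  have hA := one_sub_sq_pos hx
  rw [lintegral_kernel_weight_even s hx]
  have hx2 : 0 ≤ x ^ 2 := sq_nonneg x
  have hE : ∀ t ∈ Ioo (-1 : ℝ) 1, 0 < 1 - x ^ 2 * t ^ 2 := fun t ht => by
    nlinarith [one_sub_sq_pos ht, mul_nonneg hx2 (one_sub_sq_pos ht).le]
  have hAs := Real.sqrt_pos.2 hA
  have hAq := Real.sq_sqrt hA.le
  have hd' : ∀ t ∈ Ioo (-1 : ℝ) 1, HasDerivAt (fun t : ℝ => t * √(1 - x ^ 2) / √(1 - x ^ 2 * t ^ 2))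
      ((fun t => √(1 - x ^ 2) / √(1 - x ^ 2 * t ^ 2) ^ 3) t) t := fun t ht => by
    have h0 := hE t ht
    have h1 := Real.sqrt_pos.2 h0
    have h2 := Real.sq_sqrt h0.le
    have h3 : HasDerivAt (fun t : ℝ => 1 - x ^ 2 * t ^ 2) (-(x ^ 2 * (2 * t))) t := by
      simpa using (((hasDerivAt_id t).pow 2).const_mul (x ^ 2)).const_sub 1
    refine (((hasDerivAt_id t).mul_const √(1 - x ^ 2)).div (h3.sqrt h0.ne') h1.ne').congr_deriv ?_
    simp only [id]
    field_simp
    linear_combination h2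
  have himg : (fun t : ℝ => t * √(1 - x ^ 2) / √(1 - x ^ 2 * t ^ 2)) '' Ioo (-1) 1 =
      Ioo (-1) 1 := by
    ext y
    constructor
    · rintro ⟨t, ht, rfl⟩
      have h0 := hE t ht
      have h1 := Real.sqrt_pos.2 h0
      have h2 := Real.sq_sqrt h0.le
      rw [mem_Ioo, ← abs_lt, ← sq_lt_one_iff_abs_lt_one, div_pow, div_lt_one (by positivity),
        mul_pow, hAq, h2]
      nlinarith [one_sub_sq_pos ht]
    · intro hy
      have hQ : 0 < (1 - x ^ 2) + x ^ 2 * y ^ 2 := by positivity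
      have hQs := Real.sqrt_pos.2 hQ
      have hQq := Real.sq_sqrt hQ.le
      refine ⟨y / √((1 - x ^ 2) + x ^ 2 * y ^ 2), ?_, ?_⟩
      · rw [mem_Ioo, ← abs_lt, ← sq_lt_one_iff_abs_lt_one, div_pow, div_lt_one (by positivity), hQq]
        nlinarith [one_sub_sq_pos hy]
      · have e : 1 - x ^ 2 * (y / √((1 - x ^ 2) + x ^ 2 * y ^ 2)) ^ 2 =
            (1 - x ^ 2) / ((1 - x ^ 2) + x ^ 2 * y ^ 2) := by
          rw [div_pow, hQq]
          field_simp
          ring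
        simp only [e]
        rw [Real.sqrt_div hA.le]
        field_simp
  have hinj : InjOn (fun t : ℝ => t * √(1 - x ^ 2) / √(1 - x ^ 2 * t ^ 2)) (Ioo (-1) 1) := by
    refine (strictMonoOn_of_deriv_pos (convex_Ioo _ _)
      (fun t ht => (hd' t ht).continuousAt.continuousWithinAt) ?_).injOn
    intro t ht
    rw [interior_Ioo] at ht
    rw [(hd' t ht).deriv]
    have := Real.sqrt_pos.2 (hE t ht)
    positivity
  conv_rhs => rw [← himg]
  rw [lintegral_image_eq_lintegral_abs_deriv_mul measurableSet_Ioo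
    (fun t ht => (hd' t ht).hasDerivWithinAt) hinj]
  refine setLIntegral_congr_fun measurableSet_Ioo fun t ht => ?_
  have h0 := hE t ht
  have hp := Real.sqrt_pos.2 h0
  have hq := Real.sq_sqrt h0.le
  have hB := one_sub_sq_pos ht
  rw [← ENNReal.ofReal_mul (by positivity)]
  congr 1
  have e2 : 1 - (t * √(1 - x ^ 2) / √(1 - x ^ 2 * t ^ 2)) ^ 2 =
      (1 - t ^ 2) / √(1 - x ^ 2 * t ^ 2) ^ (2 : ℝ) := by
    rw [Real.rpow_two, div_pow, mul_pow, hAq, hq, eq_div_iff h0.ne', sub_mul,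
      div_mul_cancel₀ _ h0.ne']
    ring
  have e3 : (1 - x ^ 2) ^ ((1 - s) / 2) = √(1 - x ^ 2) ^ (1 - s) := by
    conv_lhs => rw [← hAq, ← Real.rpow_two, ← Real.rpow_mul hAs.le]
    congr 1
    ring
  have e4 : 1 - x ^ 2 * t ^ 2 = √(1 - x ^ 2 * t ^ 2) ^ 2 := hq.symm
  rw [e3, weight, weight, e2]
  conv_lhs => rw [e4]
  generalize √(1 - x ^ 2) = p at *
  generalize √(1 - x ^ 2 * t ^ 2) = q at *
  rw [abs_of_pos (show 0 < p / q ^ 3 by positivity), abs_div, abs_mul, abs_of_pos hAs, abs_of_pos hp,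
    Real.div_rpow (by positivity) hp.le, Real.mul_rpow (abs_nonneg _) hAs.le,
    Real.div_rpow hB.le (by positivity), ← Real.rpow_mul hp.le]
  have f1 : p ^ (1 - s) = p * p ^ (-s) := by
    rw [show (1 - s) = 1 + -s by ring, Real.rpow_add hAs, Real.rpow_one]
  have f2 : q ^ (-s) * q ^ (2 * ((s - 1) / 2)) = q⁻¹ := by
    rw [← Real.rpow_add hp, ← Real.rpow_neg_one]
    ring_nf
  have f3 : q ^ (-s) ≠ 0 := (Real.rpow_pos_of_pos hp _).ne'
  have f4 : q ^ (2 * ((s - 1) / 2)) ≠ 0 := (Real.rpow_pos_of_pos hp _).ne'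
  rw [f1]
  symm
  calc _ = p * p ^ (-s) * |t| ^ (-s) * (1 - t ^ 2) ^ ((s - 1) / 2) /
        (q ^ 3 * (q ^ (-s) * q ^ (2 * ((s - 1) / 2)))) := by
        field_simp
    _ = _ := by
        rw [f2]
        field_simp

/-- With `v = y²` this is a beta integral whose parameters add up to `1`, so Euler's reflection
formula evaluates it. -/
theorem lintegral_abs_rpow_mul_weight {s : ℝ} (hs : |s| < 1) :
    ∫⁻ y in Ioo (-1 : ℝ) 1, ENNReal.ofReal (|y| ^ (-s) * weight s y) =
      ENNReal.ofReal (Real.pi / Real.cos (Real.pi * s / 2)) := by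
  obtain ⟨hs1, hs2⟩ := abs_lt.1 hs
  have ha : 0 < (1 - s) / 2 := by linarith
  have hb : 0 < (1 + s) / 2 := by linarith
  have hbeta : ProbabilityTheory.beta ((1 - s) / 2) ((1 + s) / 2) =
      Real.pi / Real.cos (Real.pi * s / 2) := by
    rw [ProbabilityTheory.beta, show (1 - s) / 2 + (1 + s) / 2 = 1 by ring, Real.Gamma_one, div_one,
      show (1 + s) / 2 = 1 - (1 - s) / 2 by ring, Real.Gamma_mul_Gamma_one_sub]
    congr 1
    rw [← Real.sin_pi_div_two_sub]
    congr 1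
    ring
  rw [lintegral_Ioo_eq_mul_left (fun t => by simp [weight]), ← hbeta, ← lintegral_beta ha hb]
  have himg : (fun y : ℝ => y ^ 2) '' Ioo 0 1 = Ioo 0 1 := by
    ext v
    constructor
    · rintro ⟨y, hy, rfl⟩
      exact ⟨by have := hy.1; positivity, by dsimp only; nlinarith [hy.1, hy.2]⟩
    · intro hv
      refine ⟨√v, ⟨Real.sqrt_pos.2 hv.1, ?_⟩, Real.sq_sqrt hv.1.le⟩
      rw [Real.sqrt_lt' one_pos]
      simpa using hv.2
  have hd : ∀ y ∈ Ioo (0 : ℝ) 1,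
      HasDerivWithinAt (fun y : ℝ => y ^ 2) ((fun y => 2 * y) y) (Ioo 0 1) y := fun y _ => by
    simpa using (hasDerivAt_pow 2 y).hasDerivWithinAt
  have hinj : InjOn (fun y : ℝ => y ^ 2) (Ioo 0 1) := fun y hy z hz h =>
    (pow_left_inj₀ hy.1.le hz.1.le two_ne_zero).1 h
  conv_rhs => rw [← himg]
  rw [lintegral_image_eq_lintegral_abs_deriv_mul measurableSet_Ioo hd hinj,
    ← lintegral_const_mul _ (by have := measurable_weight s; fun_prop)]
  refine setLIntegral_congr_fun measurableSet_Ioo fun y hy => ?_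
  have hy0 : 0 < y := hy.1
  have hB : 0 < 1 - y ^ 2 := one_sub_sq_pos ⟨by linarith, hy.2⟩
  rw [← ENNReal.ofReal_mul (by positivity), ← ENNReal.ofReal_ofNat,
    ← ENNReal.ofReal_mul (by positivity)]
  congr 1
  have e1 : (y ^ 2) ^ ((1 - s) / 2 - 1) = y ^ (-s) * y⁻¹ := by
    rw [← Real.rpow_two, ← Real.rpow_mul hy0.le, ← Real.rpow_neg_one, ← Real.rpow_add hy0]
    ring_nf
  rw [abs_of_pos (by positivity : 0 < 2 * y), abs_of_pos hy0, e1, weight,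
    show (1 + s) / 2 - 1 = (s - 1) / 2 by ring]
  field_simp

theorem cos_half_pos {s : ℝ} (hs : |s| < 1) : 0 < Real.cos (Real.pi * s / 2) := by
  obtain ⟨hs1, hs2⟩ := abs_lt.1 hs
  apply Real.cos_pos_of_mem_Ioo
  constructor <;> nlinarith [Real.pi_pos]

/-- The weight is the equilibrium density of the kernel: its potential is constant. -/
theorem kernel_weight {s : ℝ} (hs : |s| < 1) {x : ℝ} (hx : x ∈ Ioo (-1 : ℝ) 1) :
    Integrable (fun y => |x - y| ^ (-s) * weight s y) muI ∧
      ∫ y, |x - y| ^ (-s) * weight s y ∂muI = Real.pi / Real.cos (Real.pi * s / 2) := by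
  refine integral_eq_of_lintegral_ofReal ?_ ?_ (div_pos Real.pi_pos (cos_half_pos hs)).le ?_
  · have := measurable_weight s
    fun_prop
  · intro y hy
    have := weight_pos s hy
    positivity
  · rw [lintegral_kernel_weight_eq_zero s hx, lintegral_abs_rpow_mul_weight hs]

/-! ### The Riesz potential of weighted polynomials -/

/-- The potential `x ↦ ∫ |x - y|^{-s} (1 - y²)^{(s-1)/2} p(y) dy`. -/
noncomputable def potential (s : ℝ) (p : ℝ[X]) (x : ℝ) : ℝ :=
  ∫ y, |x - y| ^ (-s) * (weight s y * p.eval y) ∂muI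

theorem integrable_kernel_weight_mul {s : ℝ} (hs : |s| < 1) {x : ℝ} (hx : x ∈ Ioo (-1 : ℝ) 1)
    {φ : ℝ → ℝ} (hφ : ContinuousOn φ (Icc (-1 : ℝ) 1)) :
    Integrable (fun y => |x - y| ^ (-s) * (weight s y * φ y)) muI := by
  simpa only [mul_assoc] using integrable_mul_continuousOn (kernel_weight hs hx).1 hφ

/-- Fubini is available for every integrable `g` because the potential of the weight is constant,
hence bounded. -/
theorem integrable_kernel_prod {s : ℝ} (hs : |s| < 1) {g : ℝ → ℝ} (hg : Integrable g muI)
    (p : ℝ[X]) :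
    Integrable (fun z : ℝ × ℝ => g z.1 * (|z.1 - z.2| ^ (-s) * (weight s z.2 * p.eval z.2)))
      (muI.prod muI) := by
  have hm : AEStronglyMeasurable
      (fun z : ℝ × ℝ => g z.1 * (|z.1 - z.2| ^ (-s) * (weight s z.2 * p.eval z.2)))
      (muI.prod muI) := by
    refine hg.aestronglyMeasurable.comp_fst.mul (Measurable.aestronglyMeasurable ?_)
    have h1 := measurable_weight s
    have h2 : Measurable fun y => p.eval y := p.continuous.measurable
    fun_prop
  obtain ⟨M, hM⟩ := isCompact_Icc.exists_bound_of_continuousOn (p.continuousOn (s := Icc (-1) 1))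
  rw [integrable_prod_iff hm]
  constructor
  · filter_upwards [ae_mem_Ioo] with x hx
    exact (integrable_kernel_weight_mul hs hx p.continuousOn).const_mul _
  · refine Integrable.mono' (hg.norm.mul_const (M * (Real.pi / Real.cos (Real.pi * s / 2))))
      hm.norm.integral_prod_right' ?_
    filter_upwards [ae_mem_Ioo] with x hx
    have hk := kernel_weight hs hx
    rw [Real.norm_of_nonneg (integral_nonneg fun _ => norm_nonneg _)]
    simp only [norm_mul]
    rw [integral_const_mul]
    gcongr
    rw [← hk.2, ← integral_const_mul]
    refine integral_mono_ae ?_ (hk.1.const_mul _) ?_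
    · simpa only [norm_mul] using (integrable_kernel_weight_mul hs hx (p.continuousOn)).norm
    · filter_upwards [ae_mem_Ioo] with y hy
      have hw := weight_pos s hy
      have := hM y (Ioo_subset_Icc_self hy)
      rw [Real.norm_of_nonneg (by positivity), Real.norm_of_nonneg hw.le]
      calc |x - y| ^ (-s) * (weight s y * ‖p.eval y‖) ≤ |x - y| ^ (-s) * (weight s y * M) := by
            gcongr
        _ = _ := by ring

theorem integral_mul_potential {s : ℝ} (hs : |s| < 1) {g : ℝ → ℝ} (hg : Integrable g muI)
    (p : ℝ[X]) :
    ∫ x, g x * potential s p x ∂muI =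
      ∫ y, weight s y * p.eval y * (∫ x, |x - y| ^ (-s) * g x ∂muI) ∂muI := by
  have h := integral_integral_swap (f := fun x y => g x * (|x - y| ^ (-s) *
    (weight s y * p.eval y))) (integrable_kernel_prod hs hg p)
  simp only [potential, ← integral_const_mul]
  rw [h]
  refine integral_congr_ae (Filter.Eventually.of_forall fun y => ?_)
  refine integral_congr_ae (Filter.Eventually.of_forall fun x => ?_)
  simp only
  ring

theorem potential_symm {s : ℝ} (hs : |s| < 1) (p q : ℝ[X]) :
    ∫ x, weight s x * q.eval x * potential s p x ∂muI =
      ∫ x, weight s x * p.eval x * potential s q x ∂muI := by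
  have h1 : -1 < s := (abs_lt.1 hs).1
  rw [integral_mul_potential hs (integrable_mul_continuousOn (integrable_weight h1) q.continuousOn)]
  simp only [potential, abs_sub_comm]

/-! ### Antiderivative of the kernel and the potential of `X * p`. -/

theorem intervalIntegrable_abs_rpow {s : ℝ} (hs : s < 1) (a b : ℝ) :
    IntervalIntegrable (fun t : ℝ => |t| ^ (-s)) volume a b := by
  have h0 : ∀ c : ℝ, 0 ≤ c → IntervalIntegrable (fun t : ℝ => |t| ^ (-s)) volume 0 c := by
    intro c hc
    refine (intervalIntegral.intervalIntegrable_rpow' (r := -s) (by linarith)).congr ?_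
    intro t ht
    rw [uIoc_of_le hc] at ht
    simp only [abs_of_pos ht.1]
  have h1 : ∀ c : ℝ, IntervalIntegrable (fun t : ℝ => |t| ^ (-s)) volume 0 c := by
    intro c
    rcases le_total 0 c with h | h
    · exact h0 c h
    · have := h0 (-c) (by linarith)
      rw [IntervalIntegrable.iff_comp_neg] at this
      simpa using this
  exact (h1 a).symm.trans (h1 b)

theorem integral_abs_rpow {s : ℝ} (hs : s < 1) (a : ℝ) :
    (1 - s) * ∫ t in (0 : ℝ)..a, |t| ^ (-s) = a * |a| ^ (-s) := by
  have hs' : 1 - s ≠ 0 := by linarith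
  have h0 : ∀ c : ℝ, 0 ≤ c → (1 - s) * ∫ t in (0 : ℝ)..c, |t| ^ (-s) = c * |c| ^ (-s) := by
    intro c hc
    have h1 : ∫ t in (0 : ℝ)..c, |t| ^ (-s) = ∫ t in (0 : ℝ)..c, t ^ (-s) := by
      refine intervalIntegral.integral_congr fun t ht => ?_
      rw [uIcc_of_le hc] at ht
      simp only [abs_of_nonneg ht.1]
    rw [h1, integral_rpow (Or.inl (by linarith)), Real.zero_rpow (by linarith), abs_of_nonneg hc,
      ← Real.rpow_one_add' hc (by linarith)]
    rw [show -s + 1 = 1 - s by ring, show 1 + -s = 1 - s by ring]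
    field_simp
    ring
  rcases le_total 0 a with h | h
  · exact h0 a h
  · have h1 := h0 (-a) (by linarith)
    have h2 := intervalIntegral.integral_comp_neg (a := 0) (b := a) (fun t : ℝ => |t| ^ (-s))
    simp only [abs_neg, neg_zero] at h1 h2
    rw [h2, intervalIntegral.integral_symm]
    linear_combination -h1

theorem integral_abs_sub_rpow {s : ℝ} (hs : s < 1) (x y : ℝ) :
    (1 - s) * ∫ z in (0 : ℝ)..x, |z - y| ^ (-s) =
      (x - y) * |x - y| ^ (-s) - (0 - y) * |0 - y| ^ (-s) := by
  rw [intervalIntegral.integral_comp_sub_right (fun t : ℝ => |t| ^ (-s)),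
    ← integral_abs_rpow hs (x - y), ← integral_abs_rpow hs (0 - y),
    ← intervalIntegral.integral_interval_sub_left (intervalIntegrable_abs_rpow hs 0 (x - y))
      (intervalIntegrable_abs_rpow hs 0 (0 - y)), mul_sub]

/-- With `g` a signed indicator, `∫₀ˣ` of a potential falls under `integral_mul_potential`. -/
theorem intervalIntegral_eq_integral_muI {x : ℝ} (hx : x ∈ Ioo (-1 : ℝ) 1) :
    ∃ g : ℝ → ℝ, Integrable g muI ∧ ∀ h : ℝ → ℝ, ∫ z in (0 : ℝ)..x, h z = ∫ z, g z * h z ∂muI := by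
  have hsub : uIoc 0 x ⊆ Ioo (-1 : ℝ) 1 := by
    intro z hz
    rcases mem_uIoc.1 hz with h | h
    · exact ⟨by linarith [h.1], by linarith [h.2, hx.2]⟩
    · exact ⟨by linarith [h.1, hx.1], by linarith [h.2]⟩
  refine ⟨(uIoc 0 x).indicator fun _ => if (0 : ℝ) ≤ x then 1 else -1,
    (integrable_const _).indicator measurableSet_uIoc, fun h => ?_⟩
  rw [intervalIntegral.intervalIntegral_eq_integral_uIoc]
  have : (fun z => (uIoc 0 x).indicator (fun _ => if (0 : ℝ) ≤ x then (1 : ℝ) else -1) z * h z) =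
      (uIoc 0 x).indicator fun z => (if (0 : ℝ) ≤ x then (1 : ℝ) else -1) * h z := by
    ext z
    by_cases hz : z ∈ uIoc 0 x <;> simp [hz]
  rw [this, integral_indicator measurableSet_uIoc, Measure.restrict_restrict measurableSet_uIoc,
    inter_eq_left.2 hsub, integral_const_mul, smul_eq_mul]

/-- Multiplication by `X` and the potential commute up to an antiderivative. -/
theorem potential_X_mul {s : ℝ} (hs : |s| < 1) (p : ℝ[X]) :
    ∃ c : ℝ, ∀ x ∈ Ioo (-1 : ℝ) 1,
      potential s (X * p) x =
        x * potential s p x - (1 - s) * (∫ z in (0 : ℝ)..x, potential s p z) + c := by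
  obtain ⟨hs1, hs2⟩ := abs_lt.1 hs
  have hK : ∀ x ∈ Ioo (-1 : ℝ) 1, Integrable
      (fun y => (x - y) * |x - y| ^ (-s) * (weight s y * p.eval y)) muI := fun x hx => by
    refine (integrable_kernel_weight_mul hs hx (φ := fun y => (x - y) * p.eval y)
      ?_).congr (Filter.Eventually.of_forall fun y => ?_)
    · have : ContinuousOn (fun y => p.eval y) (Icc (-1 : ℝ) 1) := p.continuousOn
      fun_prop
    · simp only
      ring
  refine ⟨-∫ y, (0 - y) * |0 - y| ^ (-s) * (weight s y * p.eval y) ∂muI, fun x hx => ?_⟩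
  obtain ⟨g, hg, hgi⟩ := intervalIntegral_eq_integral_muI hx
  -- Fubini, then the antiderivative of the kernel in `z`; the lower limit `0` supplies the
  -- constant.
  have e1 : (1 - s) * ∫ z in (0 : ℝ)..x, potential s p z =
      (∫ y, (x - y) * |x - y| ^ (-s) * (weight s y * p.eval y) ∂muI) -
        ∫ y, (0 - y) * |0 - y| ^ (-s) * (weight s y * p.eval y) ∂muI := by
    rw [hgi, integral_mul_potential hs hg, ← integral_sub (hK x hx) (hK 0 (by simp)),
      ← integral_const_mul]
    refine integral_congr_ae (Filter.Eventually.of_forall fun y => ?_)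
    have h2 := integral_abs_sub_rpow hs2 x y
    rw [hgi] at h2
    have h3 : ∀ z : ℝ, |z - y| ^ (-s) * g z = g z * |z - y| ^ (-s) := fun z => mul_comm _ _
    simp only [h3]
    linear_combination (weight s y * p.eval y) * h2
  have e2 : ∫ y, (x - y) * |x - y| ^ (-s) * (weight s y * p.eval y) ∂muI =
      x * potential s p x - potential s (X * p) x := by
    rw [potential, potential, ← integral_const_mul, ← integral_sub
      ((integrable_kernel_weight_mul hs hx p.continuousOn).const_mul _)
      (integrable_kernel_weight_mul hs hx (X * p).continuousOn)]
    refine integral_congr_ae (Filter.Eventually.of_forall fun y => ?_)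
    simp only [eval_mul, eval_X]
    ring
  rw [e1, e2]
  ring

/-! ### Eigenvalues and diagonalisation of the potential. -/

theorem exists_antiderivative (q : ℝ[X]) : ∃ a : ℝ[X], derivative a = q := by
  induction q using Polynomial.induction_on' with
  | add p q hp hq =>
    obtain ⟨a, rfl⟩ := hp
    obtain ⟨b, rfl⟩ := hq
    exact ⟨a + b, derivative_add⟩
  | monomial n c =>
    refine ⟨monomial (n + 1) (c / (n + 1)), ?_⟩
    rw [derivative_monomial_succ]
    congr 1
    have : (n : ℝ) + 1 ≠ 0 := by positivity
    field_simp

theorem natCast_add_ne_zero {s : ℝ} (hs : -1 < s) (hs0 : s ≠ 0) (n : ℕ) : (n : ℝ) + s ≠ 0 := by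
  rcases Nat.eq_zero_or_pos n with rfl | hn
  · simpa using hs0
  · have : (1 : ℝ) ≤ n := by exact_mod_cast hn
    linarith

theorem Gamma_ne_zero_of_neg_one_lt {s : ℝ} (hs : -1 < s) (hs0 : s ≠ 0) : Real.Gamma s ≠ 0 := by
  have h1 : Real.Gamma (s + 1) ≠ 0 := (Real.Gamma_pos_of_pos (by linarith)).ne'
  rw [Real.Gamma_add_one hs0] at h1
  exact right_ne_zero_of_mul h1

theorem rieszEigenvalue_zero {s : ℝ} (hs : -1 < s) (hs0 : s ≠ 0) :
    rieszEigenvalue s 0 = Real.pi / Real.cos (Real.pi * s / 2) := by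
  have := Gamma_ne_zero_of_neg_one_lt hs hs0
  rw [rieszEigenvalue]
  simp only [Nat.cast_zero, zero_add, Real.Gamma_one, mul_one]
  rw [mul_comm Real.pi (Real.Gamma s), mul_div_mul_left _ _ this]

theorem rieszEigenvalue_succ {s : ℝ} (hs : -1 < s) (hs0 : s ≠ 0) (n : ℕ) :
    rieszEigenvalue s (n + 1) = (n + s) / (n + 1) * rieszEigenvalue s n := by
  have h1 := natCast_add_ne_zero hs hs0 n
  have h2 : (n : ℝ) + 1 ≠ 0 := by positivity
  rw [rieszEigenvalue, rieszEigenvalue]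
  push_cast
  rw [show (n : ℝ) + 1 + s = n + s + 1 by ring, Real.Gamma_add_one h1, Real.Gamma_add_one h2,
    div_mul_div_comm]
  congr 1 <;> ring

theorem rieszEigenvalue_ne_zero {s : ℝ} (hs : |s| < 1) (hs0 : s ≠ 0) (n : ℕ) :
    rieszEigenvalue s n ≠ 0 := by
  obtain ⟨hs1, hs2⟩ := abs_lt.1 hs
  induction n with
  | zero =>
    rw [rieszEigenvalue_zero hs1 hs0]
    exact (div_pos Real.pi_pos (cos_half_pos hs)).ne'
  | succ n ih =>
    rw [rieszEigenvalue_succ hs1 hs0]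
    have h1 := natCast_add_ne_zero hs1 hs0 n
    have h2 : (n : ℝ) + 1 ≠ 0 := by positivity
    positivity

theorem potential_C_add {s : ℝ} (hs : |s| < 1) (p : ℝ[X]) (c : ℝ) {x : ℝ}
    (hx : x ∈ Ioo (-1 : ℝ) 1) :
    potential s (p + C c) x = potential s p x + c * (Real.pi / Real.cos (Real.pi * s / 2)) := by
  rw [potential, potential, ← (kernel_weight hs hx).2, ← integral_const_mul, ← integral_add
    (integrable_kernel_weight_mul hs hx p.continuousOn) ((kernel_weight hs hx).1.const_mul _)]
  refine integral_congr_ae (Filter.Eventually.of_forall fun y => ?_)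
  simp only [eval_add, eval_C]
  ring

/-- The potential maps polynomials of degree at most `n` to polynomials of degree at most `n`,
multiplying the coefficient of `X ^ n` by `λ_n`. -/
theorem exists_potential_eq {s : ℝ} (hs : |s| < 1) (hs0 : s ≠ 0) (n : ℕ) (p : ℝ[X])
    (hp : p.natDegree ≤ n) :
    ∃ q : ℝ[X], q.natDegree ≤ n ∧ q.coeff n = rieszEigenvalue s n * p.coeff n ∧
      ∀ x ∈ Ioo (-1 : ℝ) 1, potential s p x = q.eval x := by
  obtain ⟨hs1, hs2⟩ := abs_lt.1 hs
  induction n generalizing p with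
  | zero =>
    refine ⟨C (rieszEigenvalue s 0 * p.coeff 0), (natDegree_C _).le, by simp, fun x hx => ?_⟩
    have h0 : potential s 0 x = 0 := by simp [potential]
    rw [eq_C_of_natDegree_le_zero hp, ← zero_add (C (p.coeff 0)), potential_C_add hs 0 _ hx, h0,
      rieszEigenvalue_zero hs1 hs0]
    simp
    ring
  | succ n ih =>
    have hdeg : p.divX.natDegree ≤ n := by
      rw [natDegree_divX_eq_natDegree_tsub_one]; omega
    obtain ⟨q, hq1, hq2, hq3⟩ := ih p.divX hdeg
    obtain ⟨a, ha⟩ := exists_antiderivative q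
    obtain ⟨c, hc⟩ := potential_X_mul hs p.divX
    have hacoeff : ∀ k : ℕ, a.coeff (k + 1) * (k + 1) = q.coeff k := fun k => by
      rw [← ha, coeff_derivative]
    have hadeg : a.natDegree ≤ n + 1 := by
      rw [natDegree_le_iff_coeff_eq_zero]
      intro N hN
      obtain ⟨k, rfl⟩ : ∃ k, N = k + 1 := ⟨N - 1, by omega⟩
      have h1 := hacoeff k
      rw [coeff_eq_zero_of_natDegree_lt (p := q) (by omega)] at h1
      have h2 : (k : ℝ) + 1 ≠ 0 := by positivity
      simpa [h2] using h1
    -- Split `p = X * p.divX + C (p.coeff 0)`. The term `a.eval 0` appears because `∫₀ˣ q = a(x) -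
    -- a(0)`.
    refine ⟨X * q - C (1 - s) * a + C ((1 - s) * a.eval 0 + c +
      p.coeff 0 * (Real.pi / Real.cos (Real.pi * s / 2))), ?_, ?_, ?_⟩
    · refine natDegree_add_le_of_degree_le ((natDegree_sub_le _ _).trans (max_le ?_ ?_))
        ((natDegree_C _).le.trans (Nat.zero_le _))
      · refine natDegree_mul_le.trans ?_
        rw [natDegree_X]; omega
      · exact (natDegree_C_mul_le _ _).trans hadeg
    · rw [coeff_add, coeff_sub, coeff_X_mul, coeff_C_mul, coeff_C_succ, add_zero, hq2,
        rieszEigenvalue_succ hs1 hs0, coeff_divX]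
      have h1 := hacoeff n
      rw [hq2, coeff_divX] at h1
      have h2 : (n : ℝ) + 1 ≠ 0 := by positivity
      field_simp
      linear_combination -(1 - s) * h1
    · intro x hx
      have hi : ∫ z in (0 : ℝ)..x, potential s p.divX z = a.eval x - a.eval 0 := by
        have h1 : ∫ z in (0 : ℝ)..x, potential s p.divX z = ∫ z in (0 : ℝ)..x, q.eval z := by
          refine intervalIntegral.integral_congr fun z hz => hq3 z ?_
          rcases mem_uIcc.1 hz with h | h
          · exact ⟨by linarith [h.1], by linarith [h.2, hx.2]⟩
          · exact ⟨by linarith [h.1, hx.1], by linarith [h.2]⟩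
        rw [h1]
        refine intervalIntegral.integral_eq_sub_of_hasDerivAt (f := fun z => a.eval z)
          (fun z _ => ?_) (q.continuous.intervalIntegrable _ _)
        rw [← ha]
        exact a.hasDerivAt z
      conv_lhs => rw [← divX_mul_X_add p, mul_comm p.divX X]
      rw [potential_C_add hs _ _ hx, hc x hx, hi, hq3 x hx]
      simp only [eval_add, eval_sub, eval_mul, eval_X, eval_C]
      ring

theorem eq_zero_of_integral_weight_sq {s : ℝ} (hs : -1 < s) (q : ℝ[X])
    (h : ∫ y, weight s y * (q.eval y * q.eval y) ∂muI = 0) : q = 0 := by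
  by_contra hq
  have hcont : ContinuousOn (fun y => q.eval y * q.eval y) (Icc (-1 : ℝ) 1) :=
    q.continuousOn.mul q.continuousOn
  rw [integral_eq_zero_iff_of_nonneg_ae _ (integrable_mul_continuousOn (integrable_weight hs) hcont)]
    at h
  · have h1 : ∀ᵐ y ∂muI, y ∈ q.rootSet ℝ := by
      filter_upwards [h, ae_mem_Ioo] with y hy hy'
      have := weight_pos s hy'
      rw [mem_rootSet]
      refine ⟨hq, ?_⟩
      simpa [this.ne'] using hy
    have h2 : muI (q.rootSet ℝ)ᶜ = 0 := h1
    have h3 : muI (q.rootSet ℝ) = 0 :=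
      (q.rootSet_finite ℝ).measure_zero _
    have h4 : muI univ = 0 := by
      rw [← union_compl_self (q.rootSet ℝ)]
      exact measure_union_null h3 h2
    simp at h4
    norm_num at h4
  · filter_upwards [ae_mem_Ioo] with y hy
    have := weight_pos s hy
    have := mul_self_nonneg (q.eval y)
    simp only [Pi.zero_apply]
    positivity

theorem integral_weight_gegenbauer_mul_of_degree_lt {s : ℝ} (hs : -1 < s) (hs0 : s ≠ 0) {n : ℕ}
    {q : ℝ[X]} (hq : q.degree < n) :
    ∫ y, weight s y * ((gegenbauer (s / 2) n).eval y * q.eval y) ∂muI = 0 := by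
  have hint : Integrable (fun y => weight s y * (gegenbauer (s / 2) n).eval y) muI :=
    integrable_mul_continuousOn (integrable_weight hs) (gegenbauer (s / 2) n).continuousOn
  have h := linear_eq_zero_of_gegenbauer (α := s / 2) (by positivity) (by linarith)
    (polyPairing _ hint) n (fun k hk => ?_) q hq
  · simpa only [polyPairing_apply, mul_assoc] using h
  · simpa only [polyPairing_apply, mul_assoc] using integral_weight_gegenbauer_mul hs hk.ne

/-- The weighted Gegenbauer polynomials are eigenfunctions of the Riesz potential on `(-1, 1)`. -/
theorem potential_gegenbauer {s : ℝ} (hs : |s| < 1) (hs0 : s ≠ 0) (n : ℕ) {x : ℝ}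
    (hx : x ∈ Ioo (-1 : ℝ) 1) :
    potential s (gegenbauer (s / 2) n) x = rieszEigenvalue s n * (gegenbauer (s / 2) n).eval x := by
  obtain ⟨hs1, hs2⟩ := abs_lt.1 hs
  set G := gegenbauer (s / 2) n with hG
  have hdeg : G.natDegree ≤ n := gegenbauer_natDegree_le _ _
  obtain ⟨P, hP1, hP2, hP3⟩ := exists_potential_eq hs hs0 n G hdeg
  -- The leading terms cancel, so `Q` has degree below `n`; it is shown to have weighted norm zero.
  set Q := P - C (rieszEigenvalue s n) * G with hQ
  have hQdeg : Q.degree < n := by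
    rw [degree_lt_iff_coeff_zero]
    intro m hm
    rw [hQ, coeff_sub, coeff_C_mul]
    rcases hm.eq_or_lt with rfl | hm
    · rw [hP2, sub_self]
    · rw [coeff_eq_zero_of_natDegree_lt (hP1.trans_lt hm),
        coeff_eq_zero_of_natDegree_lt (hdeg.trans_lt hm)]
      simp
  -- By symmetry this is the pairing of `G` with the potential of `Q`, again a polynomial of degree
  -- below `n`.
  have hPQ : ∫ y, weight s y * Q.eval y * P.eval y ∂muI = 0 := by
    have h1 : ∫ y, weight s y * Q.eval y * P.eval y ∂muI =
        ∫ y, weight s y * Q.eval y * potential s G y ∂muI := by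
      refine integral_congr_ae ?_
      filter_upwards [ae_mem_Ioo] with y hy
      rw [hP3 y hy]
    rw [h1, potential_symm hs]
    rcases Nat.eq_zero_or_pos n with h0 | hn
    · have : Q = 0 := by
        rw [← degree_eq_bot]; simpa [h0] using hQdeg
      simp [this, potential]
    · have hQn : Q.natDegree ≤ n - 1 := by
        rcases eq_or_ne Q 0 with h | h
        · simp [h]
        · have := (natDegree_lt_iff_degree_lt h).2 hQdeg
          omega
      obtain ⟨R, hR1, -, hR3⟩ := exists_potential_eq hs hs0 (n - 1) Q hQn
      have hRdeg : R.degree < n := by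
        refine (degree_le_of_natDegree_le hR1).trans_lt ?_
        exact_mod_cast (by omega : n - 1 < n)
      rw [← integral_weight_gegenbauer_mul_of_degree_lt hs1 hs0 hRdeg]
      refine integral_congr_ae ?_
      filter_upwards [ae_mem_Ioo] with y hy
      rw [hR3 y hy, mul_assoc]
  have hGQ := integral_weight_gegenbauer_mul_of_degree_lt hs1 hs0 hQdeg
  rw [← hG] at hGQ
  have hcont : ∀ p q : ℝ[X], ContinuousOn (fun y => p.eval y * q.eval y) (Icc (-1 : ℝ) 1) :=
    fun p q => p.continuousOn.mul q.continuousOn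
  have hQ0 : Q = 0 := by
    apply eq_zero_of_integral_weight_sq hs1
    have : ∀ y, weight s y * (Q.eval y * Q.eval y) = weight s y * Q.eval y * P.eval y -
        rieszEigenvalue s n * (weight s y * (G.eval y * Q.eval y)) := fun y => by
      rw [hQ]
      simp only [eval_sub, eval_mul, eval_C]
      ring
    simp_rw [this]
    rw [integral_sub, hPQ, integral_const_mul, hGQ, mul_zero, sub_zero]
    · simpa only [mul_assoc] using
        integrable_mul_continuousOn (integrable_weight hs1) (hcont Q P)
    · exact (integrable_mul_continuousOn (integrable_weight hs1) (hcont G Q)).const_mul _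
  rw [hP3 x hx, sub_eq_zero.1 (hQ.symm.trans hQ0)]
  simp

/-! ### Completeness -/

/-- Weierstrass approximation, uniform on `[-1, 1]`, against an integrable `f`. -/
theorem integral_mul_eq_zero_of_polynomial {f : ℝ → ℝ} (hf : Integrable f muI)
    (h : ∀ p : ℝ[X], ∫ y, f y * p.eval y ∂muI = 0) {φ : ℝ → ℝ}
    (hφ : ContinuousOn φ (Icc (-1 : ℝ) 1)) : ∫ y, f y * φ y ∂muI = 0 := by
  have key : ∀ ε > 0, |∫ y, f y * φ y ∂muI| ≤ ε * ∫ y, ‖f y‖ ∂muI := by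
    intro ε hε
    obtain ⟨p, hp⟩ := exists_polynomial_near_of_continuousOn (-1) 1 φ hφ ε hε
    have e : ∫ y, f y * φ y ∂muI = ∫ y, f y * (φ y - p.eval y) ∂muI := by
      simp only [mul_sub]
      rw [integral_sub (integrable_mul_continuousOn hf hφ)
        (integrable_mul_continuousOn hf p.continuousOn), h, sub_zero]
    rw [e, ← Real.norm_eq_abs, ← integral_const_mul]
    refine norm_integral_le_of_norm_le (hf.norm.const_mul ε) ?_
    filter_upwards [ae_mem_Ioo] with y hy
    have := hp y (Ioo_subset_Icc_self hy)
    rw [norm_mul, mul_comm, Real.norm_eq_abs (φ y - _), abs_sub_comm]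
    gcongr
  have h0 : 0 ≤ ∫ y, ‖f y‖ ∂muI := integral_nonneg fun _ => norm_nonneg _
  rw [← abs_eq_zero]
  refine le_antisymm (le_of_forall_pos_le_add fun δ hδ => ?_) (abs_nonneg _)
  refine (key (δ / ((∫ y, ‖f y‖ ∂muI) + 1)) (by positivity)).trans ?_
  rw [zero_add, div_mul_eq_mul_div, div_le_iff₀ (by positivity)]
  nlinarith

/-- An integrable function on `(-1, 1)` that is orthogonal to all polynomials vanishes. -/
theorem ae_eq_zero_of_polynomial {f : ℝ → ℝ} (hf : Integrable f muI)
    (h : ∀ p : ℝ[X], ∫ y, f y * p.eval y ∂muI = 0) : ∀ᵐ y ∂muI, f y = 0 := by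
  rw [ae_restrict_iff' measurableSet_Ioo]
  refine isOpen_Ioo.ae_eq_zero_of_integral_contDiff_smul_eq_zero
    (IntegrableOn.locallyIntegrableOn hf) fun g hg _ hsupp => ?_
  rw [← integral_mul_eq_zero_of_polynomial hf h hg.continuous.continuousOn,
    setIntegral_eq_integral_of_forall_compl_eq_zero]
  · refine integral_congr_ae (Filter.Eventually.of_forall fun y => ?_)
    simp only [smul_eq_mul]
    ring
  · intro y hy
    have : g y = 0 := by
      by_contra hne
      exact hy (hsupp (subset_tsupport g hne))
    simp [this]

theorem ae_eq_zero_of_gegenbauer {s : ℝ} (hs : -1 < s) (hs0 : s ≠ 0) {f : ℝ → ℝ}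
    (hf : Integrable f muI) (h : ∀ n : ℕ, ∫ y, f y * (gegenbauer (s / 2) n).eval y ∂muI = 0) :
    ∀ᵐ y ∂muI, f y = 0 := by
  refine ae_eq_zero_of_polynomial hf fun p => ?_
  exact linear_eq_zero_of_gegenbauer (α := s / 2) (by positivity) (by linarith) (polyPairing f hf)
    (p.natDegree + 1) (fun k _ => h k) p
    (degree_le_natDegree.trans_lt (by exact_mod_cast Nat.lt_succ_self _))

/-! ### Decay of the Gegenbauer coefficients of smooth functions -/

/-- The unnormalised coefficient `∫ (1 - y²)^{(s-1)/2} C_n^{(s/2)}(y) v(y) dy`. -/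
noncomputable def gegenbauerCoeff (s : ℝ) (v : ℝ → ℝ) (n : ℕ) : ℝ :=
  ∫ y, weight s y * ((gegenbauer (s / 2) n).eval y * v y) ∂muI

/-- Green's formula trades each factor `n (n + s)` for the Gegenbauer operator on `v`, which
preserves smoothness up to the endpoints. The uniform bound on `C_n` settles `k = 0`. -/
theorem exists_abs_gegenbauerCoeff_le {s : ℝ} (hs : |s| < 1) (k : ℕ) {v : ℝ → ℝ}
    (hv : ContDiffOn ℝ ∞ v (Icc (-1 : ℝ) 1)) :
    ∃ B : ℝ, ∀ n : ℕ, |((n : ℝ) * (n + s)) ^ k * gegenbauerCoeff s v n| ≤ B := by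
  obtain ⟨hs1, hs2⟩ := abs_lt.1 hs
  induction k generalizing v with
  | zero =>
    obtain ⟨M, hM0, hM⟩ := exists_abs_gegenbauer_le (α := s / 2) (by linarith) (by linarith)
    obtain ⟨N, hN⟩ := isCompact_Icc.exists_bound_of_continuousOn hv.continuousOn
    refine ⟨∫ y, weight s y * (M * N) ∂muI, fun n => ?_⟩
    rw [pow_zero, one_mul, ← Real.norm_eq_abs, gegenbauerCoeff]
    refine norm_integral_le_of_norm_le ((integrable_weight hs1).mul_const _) ?_
    filter_upwards [ae_mem_Ioo] with y hy
    have hy' := Ioo_subset_Icc_self hy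
    have hw := weight_pos s hy
    rw [norm_mul, norm_mul, Real.norm_of_nonneg hw.le]
    have h1 := hM n y hy'
    have h2 := hN y hy'
    rw [← Real.norm_eq_abs] at h1
    gcongr
  | succ k ih =>
    set I : Set ℝ := Icc (-1 : ℝ) 1
    have hI : UniqueDiffOn ℝ I := uniqueDiffOn_Icc (by norm_num)
    have hv1 : ContDiffOn ℝ ∞ (derivWithin v I) I := hv.derivWithin hI (by simp)
    have hv2 : ContDiffOn ℝ ∞ (derivWithin (derivWithin v I) I) I := hv1.derivWithin hI (by simp)
    have hd : ∀ {w : ℝ → ℝ}, ContDiffOn ℝ ∞ w I → ∀ y ∈ Ioo (-1 : ℝ) 1,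
        HasDerivAt w (derivWithin w I y) y := fun {w} hw y hy =>
      ((hw.differentiableOn (by simp)) y (Ioo_subset_Icc_self hy)).hasDerivWithinAt.hasDerivAt
        (Icc_mem_nhds hy.1 hy.2)
    have hL : ContDiffOn ℝ ∞ (fun y => (1 - y ^ 2) * derivWithin (derivWithin v I) I y -
        (s + 1) * y * derivWithin v I y) I := by
      fun_prop
    obtain ⟨B, hB⟩ := ih hL
    refine ⟨B, fun n => ?_⟩
    have key := integral_weight_gegenbauer_operator hs1 hv.continuousOn hv1.continuousOn
      hv2.continuousOn (hd hv) (hd hv1) n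
    have e : ((n : ℝ) * (n + s)) ^ (k + 1) * gegenbauerCoeff s v n =
        -(((n : ℝ) * (n + s)) ^ k * gegenbauerCoeff s
          (fun y => (1 - y ^ 2) * derivWithin (derivWithin v I) I y -
            (s + 1) * y * derivWithin v I y) n) := by
      rw [pow_succ, mul_assoc]
      unfold gegenbauerCoeff
      rw [key]
      ring
    rw [e, abs_neg]
    exact hB n

/-- Successive ratios of `h_n λ_n` from index `2` on are at least `((n + 1)/(n + 3))³`, whose
product telescopes. The constant `8` in the proof is `(1 · 2)³`. -/
theorem exists_le_norm_mul_eigenvalue {s : ℝ} (hs : |s| < 1) (hs0 : s ≠ 0) :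
    ∃ c : ℝ, 0 < c ∧ ∀ n : ℕ, c ≤ |gegenbauerNorm s (n + 2) * rieszEigenvalue s (n + 2)| *
      (((n : ℝ) + 1) * (n + 2)) ^ 3 := by
  obtain ⟨hs1, hs2⟩ := abs_lt.1 hs
  refine ⟨|gegenbauerNorm s 2 * rieszEigenvalue s 2| * 8, ?_, fun n => ?_⟩
  · have h1 := (gegenbauerNorm_pos hs1 hs0 2).ne'
    have h2 := rieszEigenvalue_ne_zero hs hs0 2
    positivity
  · induction n with
    | zero => norm_num
    | succ n ih =>
      refine ih.trans ?_
      have hn : (0 : ℝ) ≤ n := by positivity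
      have h1 := gegenbauerNorm_succ hs1 hs0 (n + 2)
      have h2 := rieszEigenvalue_succ hs1 hs0 (n + 2)
      push_cast at h1 h2
      have ha : 0 < (n : ℝ) + 3 := by positivity
      have hb : 0 < (n : ℝ) + 3 + s / 2 := by linarith
      have hc : 0 < (n : ℝ) + 2 + s / 2 := by linarith
      have hd : 0 < (n : ℝ) + 2 + s := by linarith
      have e : gegenbauerNorm s (n + 1 + 2) * rieszEigenvalue s (n + 1 + 2) =
          ((n + 2 + s / 2) * (n + 2 + s) ^ 2 / ((n + 3) ^ 2 * (n + 3 + s / 2))) *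
            (gegenbauerNorm s (n + 2) * rieszEigenvalue s (n + 2)) := by
        rw [show n + 1 + 2 = n + 2 + 1 by ring, h2]
        have : gegenbauerNorm s (n + 2 + 1) = (n + 2 + s / 2) * (n + 2 + s) *
            gegenbauerNorm s (n + 2) / ((n + 3) * (n + 3 + s / 2)) := by
          rw [eq_div_iff (by positivity), ← h1]
          ring
        rw [this, show (n : ℝ) + 2 + 1 = n + 3 by ring]
        field_simp
      have hr : (((n : ℝ) + 1) / (n + 3)) ^ 3 ≤
          (n + 2 + s / 2) * (n + 2 + s) ^ 2 / ((n + 3) ^ 2 * (n + 3 + s / 2)) := by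
        have r1 : ((n : ℝ) + 1) / (n + 3) ≤ (n + 2 + s / 2) / (n + 3 + s / 2) := by
          rw [div_le_div_iff₀ ha hb]
          nlinarith
        have r2 : ((n : ℝ) + 1) / (n + 3) ≤ (n + 2 + s) / (n + 3) := by
          gcongr ?_ / _
          linarith
        calc (((n : ℝ) + 1) / (n + 3)) ^ 3 =
            ((n + 1) / (n + 3)) * ((n + 1) / (n + 3)) ^ 2 := by ring
          _ ≤ ((n + 2 + s / 2) / (n + 3 + s / 2)) * ((n + 2 + s) / (n + 3)) ^ 2 := by gcongr
          _ = _ := by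
            field_simp
      have hpos : 0 < ((n : ℝ) + 2 + s / 2) * (n + 2 + s) ^ 2 / ((n + 3) ^ 2 * (n + 3 + s / 2)) := by
        positivity
      rw [e, abs_mul _ (gegenbauerNorm s (n + 2) * _), abs_of_pos hpos]
      push_cast
      calc |gegenbauerNorm s (n + 2) * rieszEigenvalue s (n + 2)| * (((n : ℝ) + 1) * (n + 2)) ^ 3
          = (((n : ℝ) + 1) / (n + 3)) ^ 3 *
            |gegenbauerNorm s (n + 2) * rieszEigenvalue s (n + 2)| *
              (((n : ℝ) + 1 + 1) * (n + 1 + 2)) ^ 3 := by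
            rw [show (n : ℝ) + 1 + 2 = n + 3 by ring]
            field_simp
            ring
        _ ≤ _ := by gcongr

theorem summable_abs_coeff {s : ℝ} (hs : |s| < 1) (hs0 : s ≠ 0) {u : ℝ → ℝ}
    (hu : ContDiffOn ℝ ∞ u (Icc (-1 : ℝ) 1)) :
    Summable fun n => |1 / (gegenbauerNorm s n * rieszEigenvalue s n) * gegenbauerCoeff s u n| := by
  obtain ⟨hs1, hs2⟩ := abs_lt.1 hs
  obtain ⟨c, hc0, hc⟩ := exists_le_norm_mul_eigenvalue hs hs0
  -- Three powers compensate the lower bound on `h_n λ_n`; the fourth leaves a summable `1/(n +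
  -- 1)²`.
  obtain ⟨B, hB⟩ := exists_abs_gegenbauerCoeff_le hs 4 hu
  rw [← summable_nat_add_iff 2]
  have hsum : Summable fun n : ℕ => B / c * (1 / ((n : ℝ) + 1) ^ 2) := by
    refine Summable.mul_left _ ?_
    have := (summable_nat_add_iff 1).2 (Real.summable_one_div_nat_pow.2 (by norm_num : 1 < 2))
    simpa using this
  refine Summable.of_nonneg_of_le (fun n => abs_nonneg _) (fun n => ?_) hsum
  have h1 := hc n
  have h2 := hB (n + 2)
  have hB0 : 0 ≤ B := (abs_nonneg _).trans h2
  have hn : (0 : ℝ) ≤ n := by positivity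
  set d := |gegenbauerNorm s (n + 2) * rieszEigenvalue s (n + 2)|
  set J := gegenbauerCoeff s u (n + 2)
  have hd : 0 < d := by
    by_contra h
    have : d * (((n : ℝ) + 1) * (n + 2)) ^ 3 ≤ 0 :=
      mul_nonpos_of_nonpos_of_nonneg (not_lt.1 h) (by positivity)
    linarith
  have h3 : (((n : ℝ) + 1) * (n + 2)) ^ 4 * |J| ≤ B := by
    refine le_trans ?_ h2
    rw [abs_mul, abs_pow]
    gcongr
    refine le_trans ?_ (le_abs_self _)
    push_cast
    nlinarith
  set m : ℝ := ((n : ℝ) + 1) * (n + 2) with hm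
  have hm0 : 0 < m := by positivity
  have hmle : ((n : ℝ) + 1) ^ 2 ≤ m := by nlinarith
  rw [abs_mul, abs_div, abs_one]
  change 1 / d * |J| ≤ _
  have h4 : |J| ≤ B / m ^ 4 := by
    rw [le_div_iff₀ (by positivity)]
    linarith
  have h5 : 1 / d ≤ m ^ 3 / c := by
    rw [div_le_div_iff₀ hd hc0]
    linarith
  calc 1 / d * |J| ≤ m ^ 3 / c * (B / m ^ 4) := by gcongr
    _ = B / c * (1 / m) := by field_simp
    _ ≤ _ := by gcongr

theorem abs_rieszEigenvalue_le {s : ℝ} (hs : |s| < 1) (hs0 : s ≠ 0) (n : ℕ) :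
    |rieszEigenvalue s n| ≤ |rieszEigenvalue s 0| := by
  obtain ⟨hs1, hs2⟩ := abs_lt.1 hs
  induction n with
  | zero => rfl
  | succ n ih =>
    have hn : (0 : ℝ) ≤ n := by positivity
    rw [rieszEigenvalue_succ hs1 hs0, abs_mul]
    refine le_trans (mul_le_of_le_one_left (abs_nonneg _) ?_) ih
    rw [abs_div, abs_of_pos (by positivity : 0 < (n : ℝ) + 1), div_le_one (by positivity), abs_le]
    constructor <;> linarith

theorem summable_abs_coeff_div_norm {s : ℝ} (hs : |s| < 1) (hs0 : s ≠ 0) {u : ℝ → ℝ}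
    (hu : ContDiffOn ℝ ∞ u (Icc (-1 : ℝ) 1)) :
    Summable fun n => |gegenbauerCoeff s u n / gegenbauerNorm s n| := by
  refine Summable.of_nonneg_of_le (fun n => abs_nonneg _) (fun n => ?_)
    ((summable_abs_coeff hs hs0 hu).mul_left |rieszEigenvalue s 0|)
  have h1 := rieszEigenvalue_ne_zero hs hs0 n
  have h2 := (gegenbauerNorm_pos (abs_lt.1 hs).1 hs0 n).ne'
  have e : gegenbauerCoeff s u n / gegenbauerNorm s n = rieszEigenvalue s n *
      (1 / (gegenbauerNorm s n * rieszEigenvalue s n) * gegenbauerCoeff s u n) := by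
    field_simp
  rw [e, abs_mul (rieszEigenvalue s n)]
  exact mul_le_mul_of_nonneg_right (abs_rieszEigenvalue_le hs hs0 n) (abs_nonneg _)

/-! ### Absolutely convergent Gegenbauer series -/

/-- Termwise integration, applied with `k` the weight, the weight times `C_m`, and the kernel times
the weight. -/
theorem hasSum_integral_series {k : ℝ → ℝ} (hk : Integrable k muI) {p : ℕ → ℝ[X]} {M : ℝ}
    (hM : ∀ n, ∀ x ∈ Icc (-1 : ℝ) 1, |(p n).eval x| ≤ M) {β : ℕ → ℝ}
    (hβ : Summable fun n => |β n|) :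
    HasSum (fun n => β n * ∫ y, k y * (p n).eval y ∂muI)
      (∫ y, k y * ∑' n, β n * (p n).eval y ∂muI) := by
  have hi : ∀ n, Integrable (fun y => β n * (k y * (p n).eval y)) muI := fun n =>
    (integrable_mul_continuousOn hk (p n).continuousOn).const_mul _
  suffices hs : Summable fun n => ∫ y, ‖β n * (k y * (p n).eval y)‖ ∂muI by
    have h := hasSum_integral_of_summable_integral_norm hi hs
    simp only [integral_const_mul] at h
    have e : ∀ y, k y * ∑' n, β n * (p n).eval y = ∑' n, β n * (k y * (p n).eval y) := fun y => by
      rw [← tsum_mul_left]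
      exact tsum_congr fun n => by ring
    simp only [e]
    exact h
  · refine Summable.of_nonneg_of_le (fun n => integral_nonneg fun _ => norm_nonneg _) (fun n => ?_)
      (hβ.mul_right (∫ y, ‖k y‖ * M ∂muI))
    simp only [norm_mul, Real.norm_eq_abs (β n)]
    rw [integral_const_mul]
    refine mul_le_mul_of_nonneg_left ?_ (abs_nonneg _)
    refine integral_mono_ae ?_ (hk.norm.mul_const _) ?_
    · simpa only [norm_mul] using (integrable_mul_continuousOn hk (p n).continuousOn).norm
    · filter_upwards [ae_mem_Ioo] with y hy
      have := hM n y (Ioo_subset_Icc_self hy)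
      rw [Real.norm_eq_abs ((p n).eval y)]
      gcongr

theorem summable_series {p : ℕ → ℝ[X]} {M : ℝ}
    (hM : ∀ n, ∀ x ∈ Icc (-1 : ℝ) 1, |(p n).eval x| ≤ M) {β : ℕ → ℝ}
    (hβ : Summable fun n => |β n|) {x : ℝ} (hx : x ∈ Icc (-1 : ℝ) 1) :
    Summable fun n => β n * (p n).eval x := by
  refine Summable.of_norm_bounded (hβ.mul_right M) fun n => ?_
  rw [norm_mul, Real.norm_eq_abs, Real.norm_eq_abs]
  have := hM n x hx
  gcongr

theorem continuousOn_series {p : ℕ → ℝ[X]} {M : ℝ}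
    (hM : ∀ n, ∀ x ∈ Icc (-1 : ℝ) 1, |(p n).eval x| ≤ M) {β : ℕ → ℝ}
    (hβ : Summable fun n => |β n|) :
    ContinuousOn (fun x => ∑' n, β n * (p n).eval x) (Icc (-1 : ℝ) 1) := by
  refine continuousOn_tsum (fun n => ((p n).continuousOn).const_mul (β n))
    (hβ.mul_right M) fun n x hx => ?_
  rw [norm_mul, Real.norm_eq_abs, Real.norm_eq_abs]
  have := hM n x hx
  gcongr

/-- Functions that agree almost everywhere on `(-1, 1)` agree at common points of continuity. -/
theorem eq_of_ae_eq_of_continuousAt {f g : ℝ → ℝ} (h : ∀ᵐ y ∂muI, f y = g y) {x : ℝ}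
    (hx : x ∈ Ioo (-1 : ℝ) 1) (hf : ContinuousAt f x) (hg : ContinuousAt g x) : f x = g x := by
  by_contra hne
  have h1 : ∀ᶠ y in nhds x, y ∈ Ioo (-1 : ℝ) 1 ∧ f y - g y ≠ 0 :=
    Filter.Eventually.and (isOpen_Ioo.mem_nhds hx) ((hf.sub hg).eventually_ne (sub_ne_zero.2 hne))
  have h2 := Measure.measure_pos_of_mem_nhds volume h1
  rw [ae_restrict_iff' measurableSet_Ioo] at h
  refine h2.ne' (measure_mono_null (fun y hy => ?_) h)
  simp only [mem_compl_iff, mem_ofPred_eq]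
  exact fun h3 => hy.2 (sub_eq_zero.2 (h3 hy.1))

/-- A smooth function on `[-1, 1]` is the sum of its Gegenbauer series on `(-1, 1)`. -/
theorem gegenbauer_expansion {s : ℝ} (hs : |s| < 1) (hs0 : s ≠ 0) {u : ℝ → ℝ}
    (hu : ContDiffOn ℝ ∞ u (Icc (-1 : ℝ) 1)) {x : ℝ} (hx : x ∈ Ioo (-1 : ℝ) 1) :
    ∑' n, gegenbauerCoeff s u n / gegenbauerNorm s n * (gegenbauer (s / 2) n).eval x = u x := by
  obtain ⟨hs1, hs2⟩ := abs_lt.1 hs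
  obtain ⟨M, -, hM⟩ := exists_abs_gegenbauer_le (α := s / 2) (by linarith) (by linarith)
  have hβ := summable_abs_coeff_div_norm hs hs0 hu
  have hcont := continuousOn_series hM hβ
  set g : ℝ → ℝ := fun x => ∑' n, gegenbauerCoeff s u n / gegenbauerNorm s n *
    (gegenbauer (s / 2) n).eval x with hg
  have hdiff : ContinuousOn (fun y => g y - u y) (Icc (-1 : ℝ) 1) := hcont.sub hu.continuousOn
  -- The weighted difference is orthogonal to every `C_m`, so completeness applies.
  have hae : ∀ᵐ y ∂muI, weight s y * (g y - u y) = 0 := by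
    refine ae_eq_zero_of_gegenbauer hs1 hs0
      (integrable_mul_continuousOn (integrable_weight hs1) hdiff) fun m => ?_
    have hk : Integrable (fun y => weight s y * (gegenbauer (s / 2) m).eval y) muI :=
      integrable_mul_continuousOn (integrable_weight hs1) (gegenbauer (s / 2) m).continuousOn
    have h1 := hasSum_integral_series hk hM hβ
    have h2 := hasSum_single (f := fun n => gegenbauerCoeff s u n / gegenbauerNorm s n *
      ∫ y, weight s y * (gegenbauer (s / 2) m).eval y * (gegenbauer (s / 2) n).eval y ∂muI) m
      (fun n hn => by
        simp only [mul_assoc]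
        rw [integral_weight_gegenbauer_mul hs1 hn, mul_zero])
    have h3 := h1.unique h2
    simp only [mul_assoc] at h3
    rw [integral_weight_gegenbauer_sq hs1 hs0,
      div_mul_cancel₀ _ (gegenbauerNorm_pos hs1 hs0 m).ne'] at h3
    have h4 : ∀ y, weight s y * (g y - u y) * (gegenbauer (s / 2) m).eval y =
        weight s y * ((gegenbauer (s / 2) m).eval y * g y) -
          weight s y * ((gegenbauer (s / 2) m).eval y * u y) := fun y => by ring
    simp_rw [h4]
    rw [integral_sub]
    · exact sub_eq_zero.2 h3
    · exact integrable_mul_continuousOn (integrable_weight hs1)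
        ((gegenbauer (s / 2) m).continuousOn.mul hcont)
    · exact integrable_mul_continuousOn (integrable_weight hs1)
        ((gegenbauer (s / 2) m).continuousOn.mul hu.continuousOn)
  refine eq_of_ae_eq_of_continuousAt (f := g) (g := u) ?_ hx
    (hcont.continuousAt (Icc_mem_nhds hx.1 hx.2))
    (hu.continuousOn.continuousAt (Icc_mem_nhds hx.1 hx.2))
  filter_upwards [hae, ae_mem_Ioo] with y hy hy'
  have := (weight_pos s hy').ne'
  have h5 : g y - u y = 0 := by simpa [this] using hy
  linarith

/-! ### Uniqueness and the solution formula -/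

/-- An integrable density of total integral zero with almost everywhere constant potential
vanishes, and so does the constant. -/
theorem eq_zero_of_potential_const {s : ℝ} (hs : |s| < 1) (hs0 : s ≠ 0) {f : ℝ → ℝ} {κ : ℝ}
    (hf : Integrable f muI) (hf0 : ∫ y, f y ∂muI = 0)
    (h : ∀ᵐ x ∂muI, ∫ y, |x - y| ^ (-s) * f y ∂muI = κ) : κ = 0 ∧ ∀ᵐ y ∂muI, f y = 0 := by
  obtain ⟨hs1, hs2⟩ := abs_lt.1 hs
  -- Fubini moves the kernel from `w C_n` onto `f`.
  have key : ∀ n : ℕ, rieszEigenvalue s n * ∫ y, f y * (gegenbauer (s / 2) n).eval y ∂muI =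
      κ * ∫ y, weight s y * (gegenbauer (s / 2) n).eval y ∂muI := by
    intro n
    have h1 := integral_mul_potential hs hf (gegenbauer (s / 2) n)
    have h2 : ∫ x, f x * potential s (gegenbauer (s / 2) n) x ∂muI =
        rieszEigenvalue s n * ∫ y, f y * (gegenbauer (s / 2) n).eval y ∂muI := by
      rw [← integral_const_mul]
      refine integral_congr_ae ?_
      filter_upwards [ae_mem_Ioo] with x hx
      rw [potential_gegenbauer hs hs0 n hx]
      ring
    rw [← h2, h1, ← integral_const_mul]
    refine integral_congr_ae ?_
    filter_upwards [h] with y hy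
    simp only [abs_sub_comm _ y]
    rw [hy]
    ring
  have hκ : κ = 0 := by
    have h1 := key 0
    simp only [gegenbauer, eval_one, mul_one, hf0, mul_zero] at h1
    rw [integral_weight hs1 hs0] at h1
    have := (gegenbauerNorm_pos hs1 hs0 0).ne'
    simpa [this] using h1.symm
  refine ⟨hκ, ae_eq_zero_of_gegenbauer hs1 hs0 hf fun n => ?_⟩
  have h1 := key n
  rw [hκ, zero_mul] at h1
  have := rieszEigenvalue_ne_zero hs hs0 n
  simpa [this] using h1

theorem sign_mul_sign {s : ℝ} (hs0 : s ≠ 0) : Real.sign s * Real.sign s = 1 := by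
  rcases hs0.lt_or_gt with h | h
  · rw [Real.sign_of_neg h]; norm_num
  · rw [Real.sign_of_pos h]; norm_num

/-- The coefficients of the series in the solution formula. -/
noncomputable def solutionCoeff (s : ℝ) (u : ℝ → ℝ) (n : ℕ) : ℝ :=
  1 / (gegenbauerNorm s n * rieszEigenvalue s n) * gegenbauerCoeff s u n

theorem rieszSolutionTerm_eq (s : ℝ) (u : ℝ → ℝ) (x : ℝ) (n : ℕ) :
    rieszSolutionTerm s u x n = solutionCoeff s u n * (gegenbauer (s / 2) n).eval x := by
  rw [rieszSolutionTerm, solutionCoeff, gegenbauerCoeff, integral_eq_muI]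
  simp only [gegenbauerIntegrand, weight, mul_assoc]

theorem rieszSolution_eq (s : ℝ) (u : ℝ → ℝ) (x : ℝ) :
    rieszSolution s u x = -Real.sign s * (weight s x *
      ∑' n : ℕ, solutionCoeff s u (n + 1) * (gegenbauer (s / 2) (n + 1)).eval x) := by
  simp only [rieszSolution, rieszSolutionTerm_eq, weight, mul_assoc]

end Riesz

/-! ### The solution formula and its uniqueness. -/

open Riesz

theorem proposition2p2 (s : ℝ) (hs : |s| < 1) (hs0 : s ≠ 0)
    (u : ℝ → ℝ) (hu : ContDiffOn ℝ ∞ u (Icc (-1 : ℝ) 1)) :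
    -- the integrals and the series in the formula converge
    (∀ n : ℕ, IntervalIntegrable (gegenbauerIntegrand s u n) volume (-1) 1) ∧
    (∀ x ∈ Ioo (-1 : ℝ) 1, Summable fun n : ℕ => rieszSolutionTerm s u x (n + 1)) ∧
    -- the formula is an integrable function of total integral zero
    IntervalIntegrable (rieszSolution s u) volume (-1) 1 ∧
    (∫ x in (-1 : ℝ)..1, rieszSolution s u x) = 0 ∧
    ∃ c : ℝ,
      -- which satisfies the equation at every point of the open interval
      (∀ x ∈ Ioo (-1 : ℝ) 1, RieszEquationAt s u c (rieszSolution s u) x) ∧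
      -- and it is the only one, also when the equation is only required almost everywhere
      ∀ (c' : ℝ) (f : ℝ → ℝ), IntervalIntegrable f volume (-1) 1 →
        (∫ x in (-1 : ℝ)..1, f x) = 0 →
        (∀ᵐ x ∂(volume.restrict (Ioo (-1 : ℝ) 1)), RieszEquationAt s u c' f x) →
          c' = c ∧
          (∀ᵐ x ∂(volume.restrict (Ioo (-1 : ℝ) 1)), f x = rieszSolution s u x) ∧
          (∀ x ∈ Ioo (-1 : ℝ) 1, ContinuousAt f x → f x = rieszSolution s u x) := by
  obtain ⟨hs1, hs2⟩ := abs_lt.1 hs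
  obtain ⟨M, -, hM⟩ := exists_abs_gegenbauer_le (α := s / 2) (by linarith) (by linarith)
  have hM' : ∀ n : ℕ, ∀ x ∈ Icc (-1 : ℝ) 1, |(gegenbauer (s / 2) (n + 1)).eval x| ≤ M :=
    fun n => hM (n + 1)
  have hβ : Summable fun n => |solutionCoeff s u (n + 1)| :=
    (summable_nat_add_iff 1).2 (summable_abs_coeff hs hs0 hu)
  have hcont := continuousOn_series hM' hβ
  have hw := integrable_weight hs1
  have hsol : rieszSolution s u = fun x => -Real.sign s * (weight s x *
      ∑' n : ℕ, solutionCoeff s u (n + 1) * (gegenbauer (s / 2) (n + 1)).eval x) :=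
    funext (rieszSolution_eq s u)
  have hint : Integrable (rieszSolution s u) muI := by
    rw [hsol]
    exact (integrable_mul_continuousOn hw hcont).const_mul _
  have hzero : ∫ x, rieszSolution s u x ∂muI = 0 := by
    have h1 := hasSum_integral_series hw hM' hβ
    have h2 : ∀ n : ℕ, ∫ y, weight s y * (gegenbauer (s / 2) (n + 1)).eval y ∂muI = 0 := fun n => by
      have := integral_weight_gegenbauer_mul hs1 (m := 0) (n := n + 1) (by omega)
      simpa [gegenbauer] using this
    simp only [h2, mul_zero] at h1
    rw [hsol, integral_const_mul, h1.unique hasSum_zero, mul_zero]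
  -- The constant is minus the `n = 0` term of the expansion of `u`, the term absent from the
  -- solution.
  have heq : ∀ x ∈ Ioo (-1 : ℝ) 1, RieszEquationAt s u
      (-(gegenbauerCoeff s u 0 / gegenbauerNorm s 0)) (rieszSolution s u) x := by
    intro x hx
    have hk := (kernel_weight hs hx).1
    have e : (fun y => |x - y| ^ (-s) * rieszSolution s u y) = fun y => -Real.sign s *
        (|x - y| ^ (-s) * weight s y *
          ∑' n : ℕ, solutionCoeff s u (n + 1) * (gegenbauer (s / 2) (n + 1)).eval y) := by
      ext y
      rw [rieszSolution_eq]
      ring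
    refine ⟨?_, ?_⟩
    · rw [intervalIntegrable_iff_muI, e]
      exact (integrable_mul_continuousOn hk hcont).const_mul _
    · have h1 := hasSum_integral_series hk hM' hβ
      have h2 : ∀ n : ℕ, solutionCoeff s u (n + 1) *
          ∫ y, |x - y| ^ (-s) * weight s y * (gegenbauer (s / 2) (n + 1)).eval y ∂muI =
          gegenbauerCoeff s u (n + 1) / gegenbauerNorm s (n + 1) *
            (gegenbauer (s / 2) (n + 1)).eval x := fun n => by
        have h3 := potential_gegenbauer hs hs0 (n + 1) hx
        simp only [potential, ← mul_assoc] at h3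
        have h4 := rieszEigenvalue_ne_zero hs hs0 (n + 1)
        have h5 := (gegenbauerNorm_pos hs1 hs0 (n + 1)).ne'
        rw [h3, solutionCoeff]
        field_simp
      simp only [h2] at h1
      have h6 := (summable_series hM (summable_abs_coeff_div_norm hs hs0 hu)
        (Ioo_subset_Icc_self hx)).tsum_eq_zero_add
      rw [gegenbauer_expansion hs hs0 hu hx, h1.tsum_eq] at h6
      rw [integral_eq_muI, e, integral_const_mul, ← mul_assoc, neg_mul_neg, sign_mul_sign hs0,
        one_mul]
      simp only [gegenbauer, eval_one, mul_one] at h6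
      linarith
  refine ⟨fun n => ?_, fun x hx => ?_, (intervalIntegrable_iff_muI _).2 hint,
    (integral_eq_muI _).trans hzero, -(gegenbauerCoeff s u 0 / gegenbauerNorm s 0), heq, ?_⟩
  · rw [intervalIntegrable_iff_muI]
    exact integrable_mul_continuousOn (integrable_mul_continuousOn hw
      (gegenbauer (s / 2) n).continuousOn) hu.continuousOn
  · simp only [rieszSolutionTerm_eq]
    exact summable_series hM' hβ (Ioo_subset_Icc_self hx)
  · intro c' f hf hf0 hfeq
    rw [intervalIntegrable_iff_muI] at hf
    rw [integral_eq_muI] at hf0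
    -- Subtracting the two equations and multiplying by `-sgn(s)`, whose square is `1`, gives the
    -- constant potential `κ` of the difference.
    have key := eq_zero_of_potential_const hs hs0
      (κ := -Real.sign s * (c' - -(gegenbauerCoeff s u 0 / gegenbauerNorm s 0)))
      (hf.sub hint) (by simp only [Pi.sub_apply]; rw [integral_sub hf hint, hf0, hzero, sub_zero])
      (by
        filter_upwards [hfeq, ae_mem_Ioo] with x hx hx'
        obtain ⟨a1, a2⟩ := hx
        obtain ⟨b1, b2⟩ := heq x hx'
        rw [intervalIntegrable_iff_muI] at a1 b1
        rw [integral_eq_muI] at a2 b2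
        simp only [Pi.sub_apply, mul_sub]
        rw [integral_sub a1 b1]
        have hsg := sign_mul_sign hs0
        set A := ∫ y, |x - y| ^ (-s) * f y ∂muI
        set B := ∫ y, |x - y| ^ (-s) * rieszSolution s u y ∂muI
        linear_combination (-Real.sign s) * (a2 - b2) - (A - B) * hsg)
    have hae : ∀ᵐ x ∂muI, f x = rieszSolution s u x := by
      filter_upwards [key.2] with x hx
      exact sub_eq_zero.1 hx
    refine ⟨?_, hae, fun x hx hfx => ?_⟩
    · have hsg : Real.sign s ≠ 0 := fun h => by
        have := sign_mul_sign hs0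
        rw [h] at this
        norm_num at this
      have := (mul_eq_zero.1 key.1).resolve_left (neg_ne_zero.2 hsg)
      linarith
    · refine eq_of_ae_eq_of_continuousAt hae hx hfx ?_
      rw [hsol]
      have hnhds := Icc_mem_nhds hx.1 hx.2
      exact continuousAt_const.mul (((continuousOn_weight s).continuousAt
        (isOpen_Ioo.mem_nhds hx)).mul (hcont.continuousAt hnhds))
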